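/- Let $k=\mathbb{R}$. A coalgebra $C$ over $\mathbb{R}$ (coassociative and counital) is called a chain coalgebra if its right coideals, i.e. the subspaces $N\subseteq C$ with $\Delta(N)\subseteq N\otimes C$, are linearly ordered by inclusion. For an $\mathbb{R}$-algebra $A$, the finite dual $A^\circ$ is the space of all linear forms $f:A\to\mathbb{R}$ that vanish on some two-sided ideal of $A$ of finite codimension; it is a coalgebra with counit $f\mapsto f(1)$ and with $\Delta(f)=\sum_i g_i\otimes h_i\in A^\circ\otimes A^\circ$ determined by $f(ab)=\sum_i g_i(a)h_i(b)$ for all $a,b\in A$. Let $\alpha$ be complex conjugation and let $\mathbb{C}[[x,\alpha]]$ be the ring of skew power series $\sum_{n\ge 0}a_nx^n$ with $a_n\in\mathbb{C}$ and $xw=\alpha(w)x$ for $w\in\mathbb{C}$. Then the four real coalgebras $$\mathbb{R}[[x]]^\circ,\qquad \mathbb{C}[[x]]^\circ,\qquad \mathbb{C}[[x,\alpha]]^\circ,\qquad \mathbb{H}[[x]]^\circ$$ (where $x$ commutes with the coefficients in $\mathbb{R}[[x]]$, $\mathbb{C}[[x]]$ and $\mathbb{H}[[x]]$) are infinite-dimensional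 chain coalgebras, no two of them are isomorphic, and every infinite-dimensional chain coalgebra over $\mathbb{R}$ is isomorphic, as a coalgebra, to one of them. -/

import Mathlib

open scoped TensorProduct

noncomputable section

/-! ### Right coideals and chain coalgebras -/

/-- A subspace `N` of a coalgebra `C` is a right coideal, i.e. a right subcomodule of `C`,
if `Δ(N) ⊆ N ⊗ C`. -/
def IsRightCoideal (k : Type*) {C : Type*} [Field k] [AddCommGroup C] [Module k C]
    [Coalgebra k C] (N : Submodule k C) : Prop :=
  ∀ x ∈ N, Coalgebra.comul (R := k) x ∈ LinearMap.range (N.subtype.rTensor C)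

/-- A chain coalgebra: the lattice of right coideals is linearly ordered by inclusion. -/
def IsChainCoalgebra (k C : Type*) [Field k] [AddCommGroup C] [Module k C]
    [Coalgebra k C] : Prop :=
  ∀ M N : Submodule k C, IsRightCoideal k M → IsRightCoideal k N → M ≤ N ∨ N ≤ M

/-! ### The finite dual coalgebra of an algebra -/

section Pairing

variable {k V W X Y : Type*} [Field k] [AddCommGroup V] [Module k V] [AddCommMonoid W]
  [Module k W]

/-- The map `V ⊗ W → (X × Y → k)`, `v ⊗ w ↦ ((x, y) ↦ p v x * q w y)`. -/
def tensorPairing (p : V →ₗ[k] X → k) (q : W →ₗ[k] Y → k) : V ⊗[k] W →ₗ[k] X × Y → k :=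
  TensorProduct.lift (LinearMap.mk₂ k (fun v w (z : X × Y) => p v z.1 * q w z.2)
    (fun v v' w => by ext z; simp [add_mul])
    (fun c v w => by ext z; simp [mul_assoc])
    (fun v w w' => by ext z; simp [mul_add])
    (fun c v w => by ext z; simp [mul_left_comm]))

@[simp]
lemma tensorPairing_tmul (p : V →ₗ[k] X → k) (q : W →ₗ[k] Y → k) (v : V) (w : W) (z : X × Y) :
    tensorPairing p q (v ⊗ₜ w) z = p v z.1 * q w z.2 := rfl

lemma tensorPairing_injective (p : V →ₗ[k] X → k) (q : W →ₗ[k] Y → k)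
    (hp : Function.Injective p) (hq : Function.Injective q) :
    Function.Injective (tensorPairing p q) := by
  classical
  intro t t' ht
  let b := Module.Basis.ofVectorSpace k V
  let e := TensorProduct.equivFinsuppOfBasisLeft (N := W) b
  obtain ⟨w, rfl⟩ := e.symm.surjective t
  obtain ⟨w', rfl⟩ := e.symm.surjective t'
  have hli : LinearIndependent k (fun i => p (b i)) :=
    b.linearIndependent.map' p (LinearMap.ker_eq_bot.2 hp)
  have hsum : ∀ (u : _ →₀ W) (x : X) (y : Y), tensorPairing p q (e.symm u) (x, y) =
      Finsupp.linearCombination k (fun i => p (b i))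
        (u.mapRange (fun u => q u y) (by simp)) x := by
    intro u x y
    simp only [e]
    rw [TensorProduct.equivFinsuppOfBasisLeft_symm_apply, Finsupp.sum, map_sum,
      Finsupp.linearCombination_apply, Finsupp.sum_mapRange_index (by simp), Finsupp.sum]
    simp [mul_comm]
  congr 1
  have key : ∀ y : Y, w.mapRange (fun u => q u y) (by simp) =
      w'.mapRange (fun u => q u y) (by simp) := by
    intro y
    apply hli
    ext x
    rw [← hsum, ← hsum, ht]
  ext i
  apply hq
  ext y
  simpa using DFunLike.congr_fun (key y) i

end Pairing

section FiniteDual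

variable (k A : Type*) [Field k] [Ring A] [Algebra k A]

/-- The finite dual `A°` of a `k`-algebra `A`: the linear forms on `A` that vanish on some
two-sided ideal of finite codimension. -/
def finiteDual : Submodule k (Module.Dual k A) where
  carrier := {f | ∃ I : Ideal A, I.IsTwoSided ∧ Module.Finite k (A ⧸ I) ∧ ∀ a ∈ I, f a = 0}
  zero_mem' := ⟨⊤, inferInstance, inferInstance, by simp⟩
  add_mem' := by
    rintro f g ⟨I, hI, hI', hf⟩ ⟨J, hJ, hJ', hg⟩
    refine ⟨I ⊓ J, ⟨fun b ha => ⟨I.mul_mem_right b ha.1, J.mul_mem_right b ha.2⟩⟩, ?_, fun a ha => ?_⟩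
    · let φ : A →ₗ[k] (A ⧸ I) × (A ⧸ J) :=
        ((Submodule.mkQ I).restrictScalars k).prod ((Submodule.mkQ J).restrictScalars k)
      have hφ : LinearMap.ker φ = (I ⊓ J).restrictScalars k := by
        ext a
        simp [φ]
      have h1 : Module.Finite k (A ⧸ LinearMap.ker φ) :=
        Module.Finite.equiv φ.quotKerEquivRange.symm
      rw [hφ] at h1
      exact Module.Finite.equiv (Submodule.Quotient.restrictScalarsEquiv k (I ⊓ J))
    · simp [hf a ha.1, hg a ha.2]
  smul_mem' := by
    rintro c f ⟨I, hI, hI', hf⟩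
    exact ⟨I, hI, hI', fun a ha => by simp [hf a ha]⟩

namespace finiteDual

/-- Elements of the finite dual as functions. -/
def ev : finiteDual k A →ₗ[k] A → k where
  toFun f a := f.1 a
  map_add' _ _ := rfl
  map_smul' _ _ := rfl

@[simp]
lemma ev_apply (f : finiteDual k A) (a : A) : ev k A f a = f.1 a := rfl

lemma ev_injective : Function.Injective (ev k A) := fun _ _ h =>
  Subtype.ext (LinearMap.ext fun a => congrFun h a)

/-- The map `A° ⊗ A° → (A × A → k)`, `f ⊗ g ↦ ((a, b) ↦ f a * g b)`. -/
def pairing : finiteDual k A ⊗[k] finiteDual k A →ₗ[k] A × A → k :=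
  tensorPairing (V := finiteDual k A) (W := finiteDual k A) (ev k A) (ev k A)

@[simp]
lemma pairing_tmul (f g : finiteDual k A) (z : A × A) :
    pairing k A (f ⊗ₜ g) z = f.1 z.1 * g.1 z.2 := rfl

lemma pairing_injective : Function.Injective (pairing k A) :=
  tensorPairing_injective (V := finiteDual k A) (W := finiteDual k A) _ _
    (ev_injective k A) (ev_injective k A)

/-- The map `f ↦ ((a, b) ↦ f (a * b))`. -/
def precompMul : finiteDual k A →ₗ[k] A × A → k where
  toFun f z := f.1 (z.1 * z.2)
  map_add' _ _ := rfl
  map_smul' _ _ := rfl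

lemma precompMul_mem (f : finiteDual k A) :
    precompMul k A f ∈ LinearMap.range (pairing k A) := by
  obtain ⟨f, I, hI, hI', hf⟩ := f
  let π : A →ₗ[k] A ⧸ I := (Submodule.mkQ I).restrictScalars k
  have hπ : ∀ a ∈ I, π a = 0 := fun a ha => (Submodule.Quotient.mk_eq_zero I).2 ha
  have hker : ∀ a, π a = 0 → f a = 0 := fun a ha => hf a ((Submodule.Quotient.mk_eq_zero I).1 ha)
  let b := Module.finBasis k (A ⧸ I)
  have hsurj : Function.Surjective π := Submodule.mkQ_surjective I
  choose s hs using fun i => hsurj (b i)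
  let l i : finiteDual k A := ⟨b.coord i ∘ₗ π, I, hI, hI', fun a ha => by simp [hπ a ha]⟩
  let r i : finiteDual k A := ⟨f ∘ₗ LinearMap.mulLeft k (s i), I, hI, hI', fun a ha => by
    simpa using hf _ (I.mul_mem_left _ ha)⟩
  refine ⟨∑ i, l i ⊗ₜ r i, ?_⟩
  ext ⟨x, y⟩
  have hx : x - ∑ i, b.repr (π x) i • s i ∈ I := by
    rw [← Submodule.Quotient.mk_eq_zero I]
    change π _ = 0
    rw [map_sub, map_sum]
    simp [hs, b.sum_repr]
  have h0 := hf _ (I.mul_mem_right y hx)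
  rw [sub_mul, map_sub, sub_eq_zero, Finset.sum_mul, map_sum] at h0
  rw [map_sum, Finset.sum_apply]
  simp [precompMul, l, r, h0]

/-- The comultiplication of `A°`: `Δ f` is the unique element of `A° ⊗ A°` that corresponds to
`(a, b) ↦ f (a * b)`; see `pairing_comul`. -/
def comul : finiteDual k A →ₗ[k] finiteDual k A ⊗[k] finiteDual k A :=
  (LinearEquiv.ofInjective (pairing k A) (pairing_injective k A)).symm.toLinearMap ∘ₗ
    (precompMul k A).codRestrict _ (precompMul_mem k A)

lemma pairing_comul (f : finiteDual k A) (z : A × A) :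
    pairing k A (comul k A f) z = f.1 (z.1 * z.2) := by
  have h := LinearEquiv.apply_symm_apply
    (LinearEquiv.ofInjective (pairing k A) (pairing_injective k A))
    ((precompMul k A).codRestrict _ (precompMul_mem k A) f)
  exact congrFun (congrArg Subtype.val h) z

/-- The counit of `A°`: evaluation at `1`. -/
def counit : finiteDual k A →ₗ[k] k where
  toFun f := f.1 1
  map_add' _ _ := rfl
  map_smul' _ _ := rfl

/-- The map `A° ⊗ (A° ⊗ A°) → (A × (A × A) → k)`. -/
def pairing₃ : finiteDual k A ⊗[k] (finiteDual k A ⊗[k] finiteDual k A) →ₗ[k] A × (A × A) → k :=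
  tensorPairing (V := finiteDual k A) (W := finiteDual k A ⊗[k] finiteDual k A) (ev k A) (pairing k A)

lemma pairing₃_injective : Function.Injective (pairing₃ k A) :=
  tensorPairing_injective (V := finiteDual k A) (W := finiteDual k A ⊗[k] finiteDual k A) _ _
    (ev_injective k A) (pairing_injective k A)

lemma pairing₃_assoc_tmul (t : finiteDual k A ⊗[k] finiteDual k A) (g : finiteDual k A)
    (a b c : A) :
    pairing₃ k A (TensorProduct.assoc k _ _ _ (t ⊗ₜ g)) (a, (b, c)) =
      pairing k A t (a, b) * g.1 c := by
  induction t using TensorProduct.induction_on with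
  | zero => simp
  | tmul f h => simp [pairing₃, mul_assoc]
  | add x y hx hy => simp [TensorProduct.add_tmul, hx, hy, add_mul]

lemma pairing₃_rTensor (t : finiteDual k A ⊗[k] finiteDual k A) (a b c : A) :
    pairing₃ k A (TensorProduct.assoc k _ _ _ ((comul k A).rTensor _ t)) (a, (b, c)) =
      pairing k A t (a * b, c) := by
  induction t using TensorProduct.induction_on with
  | zero => simp
  | tmul f h => simp [pairing₃_assoc_tmul, pairing_comul]
  | add x y hx hy => simp [hx, hy]

lemma pairing₃_lTensor (t : finiteDual k A ⊗[k] finiteDual k A) (a b c : A) :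
    pairing₃ k A ((comul k A).lTensor _ t) (a, (b, c)) = pairing k A t (a, b * c) := by
  induction t using TensorProduct.induction_on with
  | zero => simp
  | tmul f h => simp [pairing₃, pairing_comul]
  | add x y hx hy => simp [hx, hy]

lemma lid_rTensor_counit (t : finiteDual k A ⊗[k] finiteDual k A) (a : A) :
    (TensorProduct.lid k _ ((counit k A).rTensor _ t)).1 a = pairing k A t (1, a) := by
  induction t using TensorProduct.induction_on with
  | zero => simp
  | tmul f h => simp [counit]
  | add x y hx hy => simp [hx, hy]

lemma rid_lTensor_counit (t : finiteDual k A ⊗[k] finiteDual k A) (a : A) :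
    (TensorProduct.rid k _ ((counit k A).lTensor _ t)).1 a = pairing k A t (a, 1) := by
  induction t using TensorProduct.induction_on with
  | zero => simp
  | tmul f h => simp [counit, mul_comm]
  | add x y hx hy => simp [hx, hy]

/-- The coalgebra structure of the finite dual. -/
instance instCoalgebra : Coalgebra k (finiteDual k A) where
  comul := comul k A
  counit := counit k A
  coassoc := by
    refine LinearMap.ext fun f => pairing₃_injective k A ?_
    ext ⟨a, b, c⟩
    have h1 := pairing₃_rTensor k A (comul k A f) a b c
    have h2 := pairing₃_lTensor k A (comul k A f) a b c
    rw [pairing_comul] at h1 h2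
    simp only [LinearMap.comp_apply, LinearEquiv.coe_coe]
    rw [h1, h2, mul_assoc]
  rTensor_counit_comp_comul := by
    refine LinearMap.ext fun f => (TensorProduct.lid k _).injective ?_
    refine Subtype.ext (LinearMap.ext fun a => ?_)
    rw [LinearMap.comp_apply, lid_rTensor_counit, pairing_comul]
    simp
  lTensor_counit_comp_comul := by
    refine LinearMap.ext fun f => (TensorProduct.rid k _).injective ?_
    refine Subtype.ext (LinearMap.ext fun a => ?_)
    rw [LinearMap.comp_apply, rid_lTensor_counit, pairing_comul]
    simp

end finiteDual

end FiniteDual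

/-! ### Skew power series -/

/-- The skew power series ring `D[[x, α]]` of a `k`-algebra `D` with an automorphism `α`: formal
series `∑ aₙ xⁿ` with coefficients written on the left, multiplied by the rule `x w = α(w) x`. -/
@[ext]
structure SkewPowerSeries {k D : Type*} [Field k] [Ring D] [Algebra k D] (α : D ≃ₐ[k] D) where
  /-- The coefficients of a skew power series. -/
  coeff : ℕ → D

namespace SkewPowerSeries

variable {k D : Type*} [Field k] [Ring D] [Algebra k D] {α : D ≃ₐ[k] D}

/-- A skew power series is its sequence of coefficients. -/
def equivFun (α : D ≃ₐ[k] D) : SkewPowerSeries α ≃ (ℕ → D) where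
  toFun := coeff
  invFun := mk
  left_inv _ := rfl
  right_inv _ := rfl

instance : AddCommGroup (SkewPowerSeries α) := (equivFun α).addCommGroup

instance : Module k (SkewPowerSeries α) := (equivFun α).module k

instance : One (SkewPowerSeries α) := ⟨⟨fun n => if n = 0 then 1 else 0⟩⟩

/-- `(∑ aᵢ xⁱ) (∑ bⱼ xʲ) = ∑ₙ (∑_{i+j=n} aᵢ αⁱ(bⱼ)) xⁿ`. -/
instance : Mul (SkewPowerSeries α) :=
  ⟨fun f g => ⟨fun n => ∑ p ∈ Finset.HasAntidiagonal.antidiagonal n,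
        f.coeff p.1 * (α ^ p.1) (g.coeff p.2)⟩⟩

@[simp] lemma coeff_zero (n : ℕ) : (0 : SkewPowerSeries α).coeff n = 0 := rfl

@[simp] lemma coeff_add (f g : SkewPowerSeries α) (n : ℕ) :
    (f + g).coeff n = f.coeff n + g.coeff n := rfl

@[simp] lemma coeff_smul (c : k) (f : SkewPowerSeries α) (n : ℕ) :
    (c • f).coeff n = c • f.coeff n := rfl

lemma coeff_one (n : ℕ) : (1 : SkewPowerSeries α).coeff n = if n = 0 then 1 else 0 := rfl

lemma coeff_mul (f g : SkewPowerSeries α) (n : ℕ) :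
    (f * g).coeff n =
      ∑ p ∈ Finset.HasAntidiagonal.antidiagonal n,
        f.coeff p.1 * (α ^ p.1) (g.coeff p.2) := rfl

instance : Ring (SkewPowerSeries α) where
  __ := (inferInstance : AddCommGroup (SkewPowerSeries α))
  left_distrib f g h := by
    ext n
    simp [coeff_mul, mul_add, Finset.sum_add_distrib]
  right_distrib f g h := by
    ext n
    simp [coeff_mul, add_mul, Finset.sum_add_distrib]
  zero_mul f := by
    ext n
    simp [coeff_mul]
  mul_zero f := by
    ext n
    simp [coeff_mul]
  mul_assoc f g h := by
    ext n
    simp only [coeff_mul, map_sum, Finset.sum_mul, Finset.mul_sum, map_mul]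
    rw [Finset.sum_sigma', Finset.sum_sigma']
    refine Finset.sum_nbij' (fun ⟨⟨_, j⟩, ⟨a, b⟩⟩ => ⟨(a, b + j), (b, j)⟩)
      (fun ⟨⟨i, _⟩, ⟨a, b⟩⟩ => ⟨(i + a, b), (i, a)⟩) ?_ ?_ ?_ ?_ ?_
    · rintro ⟨⟨i, j⟩, ⟨a, b⟩⟩ hp
      simp only [Finset.mem_sigma, Finset.HasAntidiagonal.mem_antidiagonal] at hp ⊢
      constructor <;> lia
    · rintro ⟨⟨i, j⟩, ⟨a, b⟩⟩ hp
      simp only [Finset.mem_sigma, Finset.HasAntidiagonal.mem_antidiagonal] at hp ⊢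
      constructor <;> lia
    · rintro ⟨⟨i, j⟩, ⟨a, b⟩⟩ hp
      simp only [Finset.mem_sigma, Finset.HasAntidiagonal.mem_antidiagonal] at hp
      obtain ⟨-, rfl⟩ := hp
      rfl
    · rintro ⟨⟨i, j⟩, ⟨a, b⟩⟩ hp
      simp only [Finset.mem_sigma, Finset.HasAntidiagonal.mem_antidiagonal] at hp
      obtain ⟨-, rfl⟩ := hp
      rfl
    · rintro ⟨⟨i, j⟩, ⟨a, b⟩⟩ hp
      simp only [Finset.mem_sigma, Finset.HasAntidiagonal.mem_antidiagonal] at hp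
      obtain ⟨-, rfl⟩ := hp
      simp [pow_add, mul_assoc]
  one_mul f := by
    ext n
    rw [coeff_mul, Finset.sum_eq_single (0, n)]
    · simp [coeff_one]
    · rintro ⟨i, j⟩ hp hne
      have : i ≠ 0 := by
        rintro rfl
        simp at hp
        exact hne (by simp [hp])
      simp [coeff_one, this]
    · simp
  mul_one f := by
    ext n
    rw [coeff_mul, Finset.sum_eq_single (n, 0)]
    · simp [coeff_one]
    · rintro ⟨i, j⟩ hp hne
      have : j ≠ 0 := by
        rintro rfl
        simp at hp
        exact hne (by simp [hp])
      simp [coeff_one, this]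
    · simp

instance : Algebra k (SkewPowerSeries α) :=
  Algebra.ofModule
    (fun c f g => by
      ext n
      simp [coeff_mul, Finset.smul_sum])
    (fun c f g => by
      ext n
      simp [coeff_mul, Finset.smul_sum])

end SkewPowerSeries

/-! ### The four real coalgebras -/

/-- The real coalgebra `ℝ[[x]]°`. -/
abbrev RealSeriesDual : Type := finiteDual ℝ (PowerSeries ℝ)

/-- The real coalgebra `ℂ[[x]]°`. -/
abbrev ComplexSeriesDual : Type := finiteDual ℝ (PowerSeries ℂ)

/-- The real coalgebra `ℂ[[x, α]]°`, with `α` complex conjugation. -/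
abbrev SkewComplexSeriesDual : Type := finiteDual ℝ (SkewPowerSeries Complex.conjAe)

/-- The real coalgebra `ℍ[[x]]°`. -/
abbrev QuaternionSeriesDual : Type := finiteDual ℝ (PowerSeries (Quaternion ℝ))

end

/-!
The convolution algebra `C*` acts on `C` from both sides, and the right coideals of `C` are the
subspaces stable under the left action. In an infinite-dimensional chain coalgebra they form a chain
`0 ⊂ S ⊂ T ⊂ ⋯` starting with finite-dimensional subcoalgebras. The functionals vanishing on the
smallest nonzero coideal `S` form an ideal `J` of topologically nilpotent elements, and `C*/J` is a
finite-dimensional domain over `ℝ`, hence one of `ℝ`, `ℂ`, `ℍ` by Frobenius. An element `u` with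
`u² ≡ -1` modulo `J` can be corrected to the exact root `u (-u²)^(-1/2)` of `-1`, so `D = C*/J`
lifts to a subalgebra of `C*`. A functional that vanishes on `S` but not on `T`, averaged over
conjugation by `i` and `j`, yields such an `x` that commutes with `D`, or, when `D = ℂ`, possibly
anticommutes with `i`. Evaluating skew power series at `x` gives a map `D[[x, α]] → C*` whose
transpose `C → D[[x, α]]°` is injective, and therefore bijective because all proper coideals of a
chain coalgebra are finite-dimensional. The four duals are told apart by the dimension of the
smallest coideal, which is `1`, `2`, `2`, `4`, and by cocommutativity.
-/

noncomputable section

/-! ### The dual algebra of a coalgebra -/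

section DualAlgebra

variable {k C : Type*} [Field k] [AddCommGroup C] [Module k C]

variable (k C) in
/-- The dual `C*` of a coalgebra `C`, an algebra under the convolution product. -/
abbrev DualAlgebra := WithConv (C →ₗ[k] k)

namespace DualAlgebra

lemma ext_of_forall_apply {c d : C} (h : ∀ f : DualAlgebra k C, f c = f d) : c = d := by
  rw [← sub_eq_zero, ← Module.forall_dual_apply_eq_zero_iff k]
  intro f
  rw [map_sub, sub_eq_zero]
  exact h (WithConv.toConv f)

variable [Coalgebra k C]

/-- The left action of `C*` on `C`, `f ⬝ c = ∑ c₁ f(c₂)`. -/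
def leftAct : DualAlgebra k C →ₗ[k] C →ₗ[k] C where
  toFun f := (TensorProduct.rid k C).toLinearMap ∘ₗ f.ofConv.lTensor C ∘ₗ Coalgebra.comul
  map_add' f g := by ext c; simp [LinearMap.lTensor_add]
  map_smul' r f := by ext c; simp [LinearMap.lTensor_smul]

/-- The right action of `C*` on `C`, `c ⬝ f = ∑ f(c₁) c₂`. -/
def rightAct : DualAlgebra k C →ₗ[k] C →ₗ[k] C where
  toFun f := (TensorProduct.lid k C).toLinearMap ∘ₗ f.ofConv.rTensor C ∘ₗ Coalgebra.comul
  map_add' f g := by ext c; simp [LinearMap.rTensor_add]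
  map_smul' r f := by ext c; simp [LinearMap.rTensor_smul]

lemma leftAct_eq_sum {c : C} {ι : Type*} (r : Coalgebra.Repr k c ι) (f : DualAlgebra k C) :
    leftAct f c = ∑ i ∈ r.index, f (r.right i) • r.left i := by
  simp [leftAct, ← r.eq]

lemma rightAct_eq_sum {c : C} {ι : Type*} (r : Coalgebra.Repr k c ι) (f : DualAlgebra k C) :
    rightAct f c = ∑ i ∈ r.index, f (r.left i) • r.right i := by
  simp [rightAct, ← r.eq]

lemma apply_leftAct (f g : DualAlgebra k C) (c : C) : f (leftAct g c) = (f * g) c := by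
  let r := Coalgebra.Repr.arbitrary k c
  rw [leftAct_eq_sum r, r.convMul_apply, map_sum]
  exact Finset.sum_congr rfl fun i _ => by rw [map_smul, smul_eq_mul, mul_comm]

lemma apply_rightAct (f g : DualAlgebra k C) (c : C) : g (rightAct f c) = (f * g) c := by
  let r := Coalgebra.Repr.arbitrary k c
  rw [rightAct_eq_sum r, r.convMul_apply, map_sum]
  exact Finset.sum_congr rfl fun i _ => by rw [map_smul, smul_eq_mul]

lemma leftAct_rightAct (f g : DualAlgebra k C) (c : C) :
    leftAct f (rightAct g c) = rightAct g (leftAct f c) :=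
  ext_of_forall_apply fun h => by
    rw [apply_leftAct, apply_rightAct, apply_rightAct, apply_leftAct, mul_assoc]

@[simp]
lemma leftAct_one (c : C) : leftAct (1 : DualAlgebra k C) c = c :=
  ext_of_forall_apply fun h => by rw [apply_leftAct, mul_one]

@[simp]
lemma rightAct_one (c : C) : rightAct (1 : DualAlgebra k C) c = c :=
  ext_of_forall_apply fun h => by rw [apply_rightAct, one_mul]

lemma leftAct_mul (f g : DualAlgebra k C) (c : C) : leftAct (f * g) c = leftAct f (leftAct g c) :=
  ext_of_forall_apply fun h => by rw [apply_leftAct, apply_leftAct, apply_leftAct, mul_assoc]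

lemma rightAct_mul (f g : DualAlgebra k C) (c : C) :
    rightAct (f * g) c = rightAct g (rightAct f c) :=
  ext_of_forall_apply fun h => by rw [apply_rightAct, apply_rightAct, apply_rightAct, mul_assoc]

lemma one_rightAct (f : DualAlgebra k C) (c : C) : (1 : DualAlgebra k C) (rightAct f c) = f c := by
  rw [apply_rightAct, mul_one]

end DualAlgebra

end DualAlgebra

open DualAlgebra

/-! ### Right coideals and subcoalgebras -/

section Coideal

variable {k C : Type*} [Field k] [AddCommGroup C] [Module k C] [Coalgebra k C]

lemma comul_mem_range_rTensor_subtype_iff (N : Submodule k C) (c : C) :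
    Coalgebra.comul (R := k) c ∈ LinearMap.range (N.subtype.rTensor C) ↔
      ∀ f : DualAlgebra k C, leftAct f c ∈ N := by
  constructor
  · rintro ⟨t, ht⟩ f
    simp only [leftAct, LinearMap.coe_mk, AddHom.coe_mk, LinearMap.comp_apply,
      LinearEquiv.coe_coe, ← ht]
    clear ht
    induction t using TensorProduct.induction_on with
    | zero => simp
    | tmul a b => simpa using N.smul_mem _ a.2
    | add x y hx hy => simpa using N.add_mem hx hy
  · classical
    intro h
    let b := Module.Basis.ofVectorSpace k C
    let e := TensorProduct.equivFinsuppOfBasisRight (M := C) b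
    have comul_coord (i) : e (Coalgebra.comul (R := k) c) i =
        leftAct (WithConv.toConv (b.coord i)) c := by
      simp only [leftAct, LinearMap.coe_mk, AddHom.coe_mk, LinearMap.comp_apply,
        LinearEquiv.coe_coe]
      induction Coalgebra.comul (R := k) c using TensorProduct.induction_on with
      | zero => simp
      | tmul a d => simp [e]
      | add x y hx hy => simp [hx, hy]
    rw [← e.symm_apply_apply (Coalgebra.comul (R := k) c),
      TensorProduct.equivFinsuppOfBasisRight_symm_apply, Finsupp.sum]
    refine Submodule.sum_mem _ fun i _ => ⟨⟨_, ?_⟩ ⊗ₜ b i, rfl⟩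
    exact (comul_coord i).symm ▸ h _

lemma isRightCoideal_iff (N : Submodule k C) :
    IsRightCoideal k N ↔ ∀ f : DualAlgebra k C, ∀ c ∈ N, leftAct f c ∈ N := by
  simp only [IsRightCoideal, comul_mem_range_rTensor_subtype_iff]
  exact ⟨fun h f c hc => h c hc f, fun h c hc f => h f c hc⟩

lemma IsRightCoideal.leftAct_mem {N : Submodule k C} (hN : IsRightCoideal k N)
    (f : DualAlgebra k C) {c : C} (hc : c ∈ N) : leftAct f c ∈ N :=
  (isRightCoideal_iff N).1 hN f c hc

lemma isRightCoideal_bot : IsRightCoideal k (⊥ : Submodule k C) :=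
  (isRightCoideal_iff _).2 fun f c hc => by simp_all

lemma IsRightCoideal.inf {M N : Submodule k C} (hM : IsRightCoideal k M)
    (hN : IsRightCoideal k N) : IsRightCoideal k (M ⊓ N) :=
  (isRightCoideal_iff _).2 fun f _ hc => ⟨hM.leftAct_mem f hc.1, hN.leftAct_mem f hc.2⟩

lemma IsRightCoideal.map_rightAct {N : Submodule k C} (hN : IsRightCoideal k N)
    (g : DualAlgebra k C) : IsRightCoideal k (N.map (rightAct g)) := by
  rw [isRightCoideal_iff]
  rintro f _ ⟨c, hc, rfl⟩
  exact ⟨leftAct f c, hN.leftAct_mem f hc, (leftAct_rightAct f g c).symm⟩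

lemma isRightCoideal_ker_rightAct (g : DualAlgebra k C) :
    IsRightCoideal k (LinearMap.ker (rightAct g)) := by
  rw [isRightCoideal_iff]
  intro f c hc
  rw [LinearMap.mem_ker] at hc ⊢
  rw [← leftAct_rightAct, hc, map_zero]

/-- The right coideal `C* ⬝ c` generated by `c`. -/
def coidealSpan (k : Type*) {C : Type*} [Field k] [AddCommGroup C] [Module k C] [Coalgebra k C]
    (c : C) : Submodule k C :=
  LinearMap.range ((leftAct (k := k)).flip c)

lemma mem_coidealSpan_self (c : C) : c ∈ coidealSpan k c :=
  ⟨1, leftAct_one c⟩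

lemma isRightCoideal_coidealSpan (c : C) : IsRightCoideal k (coidealSpan k c) := by
  rw [isRightCoideal_iff]
  rintro f _ ⟨g, rfl⟩
  exact ⟨f * g, leftAct_mul f g c⟩

lemma IsRightCoideal.coidealSpan_le {N : Submodule k C} (hN : IsRightCoideal k N) {c : C}
    (hc : c ∈ N) : coidealSpan k c ≤ N := by
  rintro _ ⟨f, rfl⟩
  exact hN.leftAct_mem f hc

instance finiteDimensional_coidealSpan (c : C) : FiniteDimensional k (coidealSpan k c) := by
  classical
  let r := Coalgebra.Repr.arbitrary k c
  suffices coidealSpan k c ≤ Submodule.span k ((r.index.image r.left : Finset C) : Set C) from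
    Submodule.finiteDimensional_of_le this
  rintro _ ⟨f, rfl⟩
  rw [LinearMap.flip_apply, leftAct_eq_sum r]
  exact Submodule.sum_mem _ fun i hi => Submodule.smul_mem _ _
    (Submodule.subset_span (Finset.mem_image_of_mem _ hi))

/-- A subcoalgebra of `C`, encoded as a subspace stable under both actions of `C*`. -/
structure IsSubcoalgebra (N : Submodule k C) : Prop where
  leftAct_mem (f : DualAlgebra k C) {c : C} (hc : c ∈ N) : leftAct f c ∈ N
  rightAct_mem (f : DualAlgebra k C) {c : C} (hc : c ∈ N) : rightAct f c ∈ N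

namespace IsSubcoalgebra

variable {N : Submodule k C}

/-- The functionals that vanish on a subcoalgebra, an ideal of the dual algebra. -/
def annihilator (hN : IsSubcoalgebra N) : Ideal (DualAlgebra k C) where
  carrier := {f | ∀ c ∈ N, f c = 0}
  add_mem' {f g} hf hg c hc := by
    change f c + g c = 0
    rw [hf c hc, hg c hc, add_zero]
  zero_mem' _ _ := rfl
  smul_mem' g f hf c hc := by
    rw [smul_eq_mul, ← apply_rightAct]
    exact hf _ (hN.rightAct_mem g hc)

instance isTwoSided_annihilator (hN : IsSubcoalgebra N) : hN.annihilator.IsTwoSided where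
  mul_mem_of_left {f} g hf c hc := by
    rw [← apply_leftAct]
    exact hf _ (hN.leftAct_mem g hc)

lemma finiteDimensional_quotient_annihilator (hN : IsSubcoalgebra N) [FiniteDimensional k N] :
    FiniteDimensional k (DualAlgebra k C ⧸ hN.annihilator) := by
  let restrict : DualAlgebra k C →ₗ[k] Module.Dual k N :=
    (LinearMap.lcomp k k N.subtype) ∘ₗ (WithConv.linearEquiv k (C →ₗ[k] k)).toLinearMap
  have ker_restrict : LinearMap.ker restrict = hN.annihilator.restrictScalars k := by
    ext f
    exact ⟨fun h c hc => LinearMap.congr_fun h ⟨c, hc⟩, fun h => LinearMap.ext fun c => h c c.2⟩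
  have : FiniteDimensional k (DualAlgebra k C ⧸ LinearMap.ker restrict) :=
    .equiv restrict.quotKerEquivRange.symm
  rw [ker_restrict] at this
  exact .equiv (Submodule.Quotient.restrictScalarsEquiv k hN.annihilator)

lemma rightAct_eq_zero_of_mem_annihilator {hN : IsSubcoalgebra N} {f : DualAlgebra k C}
    (hf : f ∈ hN.annihilator) {c : C} (hc : c ∈ N) : rightAct f c = 0 :=
  ext_of_forall_apply fun g => by
    rw [apply_rightAct, map_zero]
    exact hN.annihilator.mul_mem_right g hf c hc

end IsSubcoalgebra

variable {D : Type*} [AddCommGroup D] [Module k D] [Coalgebra k D]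

lemma DualAlgebra.leftAct_coalgHom (φ : C →ₗc[k] D) (f : DualAlgebra k D) (c : C) :
    leftAct f (φ c) = φ (leftAct (WithConv.toConv (f.ofConv ∘ₗ φ.toLinearMap)) c) := by
  let r := Coalgebra.Repr.arbitrary k c
  rw [leftAct_eq_sum (r.induced φ), leftAct_eq_sum r, map_sum]
  exact Finset.sum_congr rfl fun i _ => (map_smul φ _ _).symm

lemma IsRightCoideal.map_coalgHom {N : Submodule k C} (hN : IsRightCoideal k N) (φ : C →ₗc[k] D) :
    IsRightCoideal k (N.map φ.toLinearMap) := by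
  rw [isRightCoideal_iff]
  rintro f _ ⟨c, hc, rfl⟩
  exact ⟨_, hN.leftAct_mem _ hc, (leftAct_coalgHom φ f c).symm⟩

end Coideal

/-! ### Chain coalgebras -/

section Chain

variable {k C : Type*} [Field k] [AddCommGroup C] [Module k C] [Coalgebra k C]

lemma IsChainCoalgebra.isSubcoalgebra (hC : IsChainCoalgebra k C) {N : Submodule k C}
    (hN : IsRightCoideal k N) [FiniteDimensional k N] : IsSubcoalgebra N where
  leftAct_mem f _ hc := hN.leftAct_mem f hc
  rightAct_mem f c hc := by
    suffices N.map (rightAct f) ≤ N from this ⟨c, hc, rfl⟩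
    rcases hC _ _ (hN.map_rightAct f) hN with h | h
    · exact h
    · exact (Submodule.eq_of_le_of_finrank_le h (Submodule.finrank_map_le _ _)).ge

lemma IsChainCoalgebra.eq_top_of_not_finiteDimensional (hC : IsChainCoalgebra k C)
    {N : Submodule k C} (hN : IsRightCoideal k N) (h : ¬ FiniteDimensional k N) : N = ⊤ := by
  refine eq_top_iff.2 fun c _ => ?_
  rcases hC _ _ (isRightCoideal_coidealSpan c) hN with h' | h'
  · exact h' (mem_coidealSpan_self c)
  · exact absurd (Submodule.finiteDimensional_of_le h') h

/-- `N` is finite-dimensional and is the smallest right coideal not contained in `M`. In a chain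
coalgebra it is the successor of `M` among the right coideals. -/
structure IsNextCoideal (M N : Submodule k C) : Prop where
  isRightCoideal : IsRightCoideal k N
  finiteDimensional : FiniteDimensional k N
  lt : M < N
  le_of_not_le : ∀ P : Submodule k C, IsRightCoideal k P → ¬ P ≤ M → N ≤ P

lemma IsChainCoalgebra.exists_isNextCoideal (hC : IsChainCoalgebra k C) {M : Submodule k C}
    (hM : IsRightCoideal k M) (hM_ne : M ≠ ⊤) : ∃ N, IsNextCoideal M N := by
  obtain ⟨c₀, -, hc₀⟩ := SetLike.exists_of_lt (lt_top_iff_ne_top.2 hM_ne)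
  obtain ⟨c, hc, hc_min⟩ := exists_minimalFor_of_wellFoundedLT (· ∉ M)
    (fun c => Module.finrank k (coidealSpan k c)) ⟨c₀, hc₀⟩
  have lt_coidealSpan : M < coidealSpan k c := by
    have not_le : ¬ coidealSpan k c ≤ M := fun h => hc (h (mem_coidealSpan_self c))
    exact lt_of_le_not_ge ((hC _ _ hM (isRightCoideal_coidealSpan c)).resolve_right not_le) not_le
  refine ⟨coidealSpan k c, isRightCoideal_coidealSpan c, inferInstance, lt_coidealSpan,
    fun P hP hPM => ?_⟩
  obtain ⟨d, hdP, hdM⟩ := SetLike.not_le_iff_exists.1 hPM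
  refine le_trans ?_ (hP.coidealSpan_le hdP)
  rcases hC _ _ (isRightCoideal_coidealSpan c) (isRightCoideal_coidealSpan d) with h | h
  · exact h
  · exact (Submodule.eq_of_le_of_finrank_le h (hc_min hdM (Submodule.finrank_mono h))).ge

lemma isChainCoalgebra_of_isNextCoideal (V : ℕ → Submodule k C) (V_zero : V 0 = ⊥)
    (V_next : ∀ n, IsNextCoideal (V n) (V (n + 1))) (V_exhaust : ∀ c, ∃ n, c ∈ V n) :
    IsChainCoalgebra k C := by
  have eq_top_or_eq (N : Submodule k C) (hN : IsRightCoideal k N) : N = ⊤ ∨ ∃ n, N = V n := by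
    by_cases h : ∀ n, V n ≤ N
    · refine .inl (eq_top_iff.2 fun c _ => ?_)
      obtain ⟨n, hn⟩ := V_exhaust c
      exact h n hn
    · classical
      push Not at h
      obtain ⟨m, hm⟩ : ∃ m, Nat.find h = m + 1 := Nat.exists_eq_succ_of_ne_zero fun h0 => by
        simpa [h0, V_zero] using Nat.find_spec h
      have hVm : V m ≤ N := not_not.1 (Nat.find_min h (by lia))
      have hNV : N ≤ V m :=
        not_not.1 fun hle => Nat.find_spec h (hm ▸ (V_next m).le_of_not_le N hN hle)
      exact .inr ⟨m, le_antisymm hNV hVm⟩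
  have V_mono : Monotone V := monotone_nat_of_le_succ fun n => (V_next n).lt.le
  intro M N hM hN
  rcases eq_top_or_eq M hM with rfl | ⟨m, rfl⟩
  · exact .inr le_top
  rcases eq_top_or_eq N hN with rfl | ⟨n, rfl⟩
  · exact .inl le_top
  · exact (le_total m n).imp (V_mono ·) (V_mono ·)

/-! ### The smallest nonzero right coideal -/

/-- `S` is the smallest nonzero right coideal. -/
abbrev IsSmallestCoideal (S : Submodule k C) : Prop := IsNextCoideal ⊥ S

namespace IsSmallestCoideal

variable {S : Submodule k C}

lemma le (hS : IsSmallestCoideal S) {N : Submodule k C} (hN : IsRightCoideal k N) (h : N ≠ ⊥) :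
    S ≤ N :=
  hS.le_of_not_le N hN (by rwa [le_bot_iff])

lemma nontrivial_quotient_annihilator (hS : IsSmallestCoideal S) (hS' : IsSubcoalgebra S) :
    Nontrivial (DualAlgebra k C ⧸ hS'.annihilator) := by
  refine Ideal.Quotient.nontrivial_iff.2 fun h => ?_
  obtain ⟨s, hs, hs_ne⟩ := Submodule.exists_mem_ne_zero_of_ne_bot hS.lt.ne'
  refine hs_ne (ext_of_forall_apply (k := k) fun f => ?_)
  rw [map_zero]
  exact (h ▸ Submodule.mem_top : f ∈ hS'.annihilator) s hs

lemma mem_annihilator_or_mem_annihilator (hS : IsSmallestCoideal S) (hS' : IsSubcoalgebra S)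
    {f g : DualAlgebra k C} (hfg : f * g ∈ hS'.annihilator) :
    f ∈ hS'.annihilator ∨ g ∈ hS'.annihilator := by
  have := hS.finiteDimensional
  refine or_iff_not_imp_left.2 fun hf => ?_
  have disjoint : S ⊓ LinearMap.ker (rightAct f) = ⊥ := by
    by_contra h
    have hle := hS.le (hS.isRightCoideal.inf (isRightCoideal_ker_rightAct f)) h
    refine hf fun c hc => ?_
    rw [← one_rightAct, LinearMap.mem_ker.1 (hle hc).2, map_zero]
  have surjective : Function.Surjective ((rightAct f).restrict fun c => hS'.rightAct_mem f) := by
    rw [← LinearMap.injective_iff_surjective, ← LinearMap.ker_eq_bot, LinearMap.ker_restrict,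
      ← Submodule.disjoint_iff_comap_eq_bot, disjoint_iff, disjoint]
  intro c hc
  obtain ⟨d, hd⟩ := surjective ⟨c, hc⟩
  obtain rfl : rightAct f d = c := congrArg Subtype.val hd
  exact (apply_rightAct f g d).trans (hfg d d.2)

lemma isDomain_quotient_annihilator (hS : IsSmallestCoideal S) (hS' : IsSubcoalgebra S) :
    IsDomain (DualAlgebra k C ⧸ hS'.annihilator) := by
  have := hS.nontrivial_quotient_annihilator hS'
  have : NoZeroDivisors (DualAlgebra k C ⧸ hS'.annihilator) := by
    refine ⟨fun {a b} => ?_⟩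
    obtain ⟨f, rfl⟩ := Ideal.Quotient.mk_surjective a
    obtain ⟨g, rfl⟩ := Ideal.Quotient.mk_surjective b
    rw [← map_mul, Ideal.Quotient.eq_zero_iff_mem, Ideal.Quotient.eq_zero_iff_mem,
      Ideal.Quotient.eq_zero_iff_mem]
    exact hS.mem_annihilator_or_mem_annihilator hS'
  exact NoZeroDivisors.to_isDomain _

lemma map_rightAct_lt (hS : IsSmallestCoideal S) (hS' : IsSubcoalgebra S) {t : DualAlgebra k C}
    (ht : t ∈ hS'.annihilator) {N : Submodule k C} (hN : IsRightCoideal k N)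
    (hN' : IsSubcoalgebra N) [FiniteDimensional k N] (hN_ne : N ≠ ⊥) : N.map (rightAct t) < N := by
  have map_le : N.map (rightAct t) ≤ N := Submodule.map_le_iff_le_comap.2 fun c =>
    hN'.rightAct_mem t
  refine lt_of_le_of_ne map_le fun map_eq => ?_
  obtain ⟨s, hs, hs_ne⟩ := Submodule.exists_mem_ne_zero_of_ne_bot hS.lt.ne'
  have surjective : Function.Surjective ((rightAct t).restrict fun c => hN'.rightAct_mem t) := by
    rintro ⟨c, hc⟩
    obtain ⟨d, hd, rfl⟩ := map_eq.ge hc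
    exact ⟨⟨d, hd⟩, rfl⟩
  have injective := LinearMap.injective_iff_surjective.2 surjective
  refine hs_ne (congrArg Subtype.val (injective (a₁ := ⟨s, hS.le hN hN_ne hs⟩) (a₂ := 0) ?_))
  rw [map_zero]
  exact Subtype.ext (IsSubcoalgebra.rightAct_eq_zero_of_mem_annihilator ht hs)

lemma rightAct_pow_eq_zero (hC : IsChainCoalgebra k C) (hS : IsSmallestCoideal S)
    (hS' : IsSubcoalgebra S) {t : DualAlgebra k C} (ht : t ∈ hS'.annihilator) (n : ℕ) :
    ∀ N : Submodule k C, IsRightCoideal k N → FiniteDimensional k N → Module.finrank k N ≤ n →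
      ∀ c ∈ N, rightAct (t ^ n) c = 0 := by
  induction n with
  | zero =>
    intro N _ _ hdim c hc
    rw [Nat.le_zero, Submodule.finrank_eq_zero] at hdim
    rw [show c = 0 from (Submodule.mem_bot k).1 (hdim ▸ hc), map_zero]
  | succ n ih =>
    intro N hN _ hdim c hc
    by_cases hN_bot : N = ⊥
    · rw [show c = 0 from (Submodule.mem_bot k).1 (hN_bot ▸ hc), map_zero]
    have finrank_lt := Submodule.finrank_lt_finrank_of_lt
      (hS.map_rightAct_lt hS' ht hN (hC.isSubcoalgebra hN) hN_bot)
    rw [pow_succ', rightAct_mul]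
    exact ih _ (hN.map_rightAct t) inferInstance (by lia) _ ⟨c, hc, rfl⟩

end IsSmallestCoideal

/-- An element `t` of the dual algebra whose powers tend to zero pointwise, i.e. in the finite
topology of `C*`: each `c` is killed by almost all powers of `t`. -/
def DualAlgebra.IsPointwiseNilpotent (t : DualAlgebra k C) : Prop :=
  ∀ c : C, ∀ᶠ m in Filter.atTop, (t ^ m) c = 0

lemma IsSmallestCoideal.isPointwiseNilpotent (hC : IsChainCoalgebra k C) {S : Submodule k C}
    (hS : IsSmallestCoideal S) (hS' : IsSubcoalgebra S) {t : DualAlgebra k C}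
    (ht : t ∈ hS'.annihilator) : t.IsPointwiseNilpotent := fun c => by
  filter_upwards [Filter.eventually_ge_atTop (Module.finrank k (coidealSpan k c))] with m hm
  rw [← one_rightAct, hS.rightAct_pow_eq_zero hC hS' ht m _ (isRightCoideal_coidealSpan c)
    inferInstance hm c (mem_coidealSpan_self c), map_zero]

lemma IsNextCoideal.ker_rightAct_le {S T : Submodule k C} (hT : IsNextCoideal S T)
    (hT' : IsSubcoalgebra T) {x : DualAlgebra k C}
    (hx : x ∉ hT'.annihilator) : LinearMap.ker (rightAct x) ≤ S := by
  by_contra h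
  have hle := hT.le_of_not_le _ (isRightCoideal_ker_rightAct x) h
  refine hx fun c hc => ?_
  rw [← one_rightAct, LinearMap.mem_ker.1 (hle hc), map_zero]

lemma IsSubcoalgebra.exists_mem_annihilator_notMem_annihilator {S T : Submodule k C}
    (hS : IsSubcoalgebra S) (hT : IsSubcoalgebra T) (h : S < T) :
    ∃ y ∈ hS.annihilator, y ∉ hT.annihilator := by
  obtain ⟨d, hdT, hdS⟩ := SetLike.exists_of_lt h
  obtain ⟨f, hfd, hfS⟩ := S.exists_le_ker_of_notMem hdS
  exact ⟨WithConv.toConv f, fun c hc => hfS hc, fun hf => hfd (hf d hdT)⟩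

/-! ### Chain coalgebras and coalgebra maps -/

variable {D : Type*} [AddCommGroup D] [Module k D] [Coalgebra k D]

lemma IsChainCoalgebra.of_injective (hD : IsChainCoalgebra k D) (φ : C →ₗc[k] D)
    (hφ : Function.Injective φ) : IsChainCoalgebra k C := fun M N hM hN => by
  simpa only [Submodule.map_le_map_iff_of_injective (f := φ.toLinearMap) hφ] using
    hD _ _ (hM.map_coalgHom φ) (hN.map_coalgHom φ)

lemma IsChainCoalgebra.bijective_of_injective (hD : IsChainCoalgebra k D)
    (hC : ¬ FiniteDimensional k C) (φ : C →ₗc[k] D) (hφ : Function.Injective φ) :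
    Function.Bijective φ := by
  have isRightCoideal_top : IsRightCoideal k (⊤ : Submodule k C) :=
    (isRightCoideal_iff _).2 fun _ _ _ => trivial
  have range_eq_top := hD.eq_top_of_not_finiteDimensional (isRightCoideal_top.map_coalgHom φ)
    fun _ => hC (.equiv ((Submodule.equivMapOfInjective φ.toLinearMap hφ ⊤).symm.trans
      Submodule.topEquiv))
  refine ⟨hφ, fun d => ?_⟩
  obtain ⟨c, -, rfl⟩ := range_eq_top.ge (Submodule.mem_top (x := d))
  exact ⟨c, rfl⟩

lemma IsSmallestCoideal.finrank_le_of_injective {S : Submodule k C} {T : Submodule k D}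
    (hS : IsSmallestCoideal S) (hT : IsSmallestCoideal T) (φ : C →ₗc[k] D)
    (hφ : Function.Injective φ) : Module.finrank k T ≤ Module.finrank k S := by
  have := hS.finiteDimensional
  have map_ne_bot : S.map φ.toLinearMap ≠ ⊥ := fun h =>
    hS.lt.ne' (Submodule.map_injective_of_injective (f := φ.toLinearMap) hφ (by simpa using h))
  exact (Submodule.finrank_mono (hT.le (hS.isRightCoideal.map_coalgHom φ) map_ne_bot)).trans
    (Submodule.finrank_map_le _ _)

lemma IsSmallestCoideal.finrank_eq_of_coalgEquiv {S : Submodule k C} {T : Submodule k D}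
    (hS : IsSmallestCoideal S) (hT : IsSmallestCoideal T) (e : C ≃ₗc[k] D) :
    Module.finrank k S = Module.finrank k T :=
  le_antisymm (hT.finrank_le_of_injective hS e.symm.toCoalgHom e.symm.injective)
    (hS.finrank_le_of_injective hT e.toCoalgHom e.injective)

end Chain

/-! ### Skew power series rings -/

namespace SkewPowerSeries

variable {k D : Type*} [Field k] [Ring D] [Algebra k D] {α : D ≃ₐ[k] D}

variable (α) in
/-- The linear map taking the `n`-th coefficient. -/
def lcoeff (n : ℕ) : SkewPowerSeries α →ₗ[k] D where
  toFun b := b.coeff n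
  map_add' _ _ := rfl
  map_smul' _ _ := rfl

lemma coeff_sub (a b : SkewPowerSeries α) (n : ℕ) : (a - b).coeff n = a.coeff n - b.coeff n :=
  map_sub (lcoeff α n) a b

lemma coeff_sum {ι : Type*} (s : Finset ι) (b : ι → SkewPowerSeries α) (n : ℕ) :
    (∑ i ∈ s, b i).coeff n = ∑ i ∈ s, (b i).coeff n :=
  map_sum (lcoeff α n) b s

variable (α) in
/-- The monomial `w xᵐ`, linearly in `w`. -/
def monomial (m : ℕ) : D →ₗ[k] SkewPowerSeries α where
  toFun w := ⟨fun n => if n = m then w else 0⟩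
  map_add' v w := by ext n; rw [coeff_add, ite_add_ite, add_zero]
  map_smul' r w := by ext n; rw [coeff_smul, smul_ite, smul_zero]; rfl

lemma coeff_monomial (m n : ℕ) (w : D) :
    (monomial α m w).coeff n = if n = m then w else 0 := rfl

@[simp]
lemma coeff_monomial_self (m : ℕ) (w : D) : (monomial α m w).coeff m = w := if_pos rfl

lemma one_eq_monomial : (1 : SkewPowerSeries α) = monomial α 0 1 := by
  ext n
  rw [coeff_one, coeff_monomial]

lemma monomial_mul_monomial (m n : ℕ) (v w : D) :
    monomial α m v * monomial α n w = monomial α (m + n) (v * (α ^ m) w) := by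
  ext l
  have term_eq_zero (p : ℕ × ℕ) (hp : p ≠ (m, n)) :
      (monomial α m v).coeff p.1 * (α ^ p.1) ((monomial α n w).coeff p.2) = 0 := by
    rw [coeff_monomial, coeff_monomial]
    split_ifs with h₁ h₂
    · exact absurd (Prod.ext h₁ h₂) hp
    all_goals simp
  rw [coeff_mul, coeff_monomial]
  split_ifs with hl
  · rw [Finset.sum_eq_single_of_mem (m, n) (Finset.HasAntidiagonal.mem_antidiagonal.2 hl.symm)
      fun p _ => term_eq_zero p, coeff_monomial_self, coeff_monomial_self]
  · refine Finset.sum_eq_zero fun p hp => term_eq_zero p ?_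
    rintro rfl
    exact hl (Finset.HasAntidiagonal.mem_antidiagonal.1 hp).symm

lemma coeff_mul_monomial_one (a : SkewPowerSeries α) (m n : ℕ) :
    (a * monomial α n 1).coeff (m + n) = a.coeff m := by
  rw [coeff_mul, Finset.sum_eq_single_of_mem (m, n)
    (Finset.HasAntidiagonal.mem_antidiagonal.2 rfl), coeff_monomial_self, map_one, mul_one]
  intro p hp hp_ne
  have sum_eq := Finset.HasAntidiagonal.mem_antidiagonal.1 hp
  have snd_ne : p.2 ≠ n := fun h => hp_ne (Prod.ext (by lia) h)
  rw [coeff_monomial, if_neg snd_ne, map_zero, mul_zero]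

/-! ### The ideals of series of order at least `n` -/

variable (α) in
/-- The ideal of skew power series of order at least `n`. -/
def orderIdeal (n : ℕ) : Ideal (SkewPowerSeries α) where
  carrier := {b | ∀ m < n, b.coeff m = 0}
  add_mem' {a b} ha hb m hm := by rw [coeff_add, ha m hm, hb m hm, add_zero]
  zero_mem' m _ := coeff_zero m
  smul_mem' a b hb m hm := by
    rw [smul_eq_mul, coeff_mul]
    refine Finset.sum_eq_zero fun p hp => ?_
    have sum_eq := Finset.HasAntidiagonal.mem_antidiagonal.1 hp
    rw [hb _ (by lia), map_zero, mul_zero]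

lemma mem_orderIdeal {n : ℕ} {b : SkewPowerSeries α} :
    b ∈ orderIdeal α n ↔ ∀ m < n, b.coeff m = 0 := Iff.rfl

instance isTwoSided_orderIdeal (n : ℕ) : (orderIdeal α n).IsTwoSided where
  mul_mem_of_left {a} b ha m hm := by
    rw [coeff_mul]
    refine Finset.sum_eq_zero fun p hp => ?_
    have sum_eq := Finset.HasAntidiagonal.mem_antidiagonal.1 hp
    rw [ha _ (by lia), zero_mul]

lemma orderIdeal_zero : orderIdeal α 0 = ⊤ :=
  eq_top_iff.2 fun _ _ _ hm => absurd hm (Nat.not_lt_zero _)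

lemma orderIdeal_antitone : Antitone (orderIdeal α) := fun _ _ h _ hb m hm =>
  hb m (hm.trans_le h)

lemma monomial_mem_orderIdeal (m : ℕ) (w : D) : monomial α m w ∈ orderIdeal α m := fun n hn => by
  rw [coeff_monomial, if_neg hn.ne]

lemma mem_orderIdeal_succ {n : ℕ} {b : SkewPowerSeries α} (hb : b ∈ orderIdeal α n)
    (hbn : b.coeff n = 0) : b ∈ orderIdeal α (n + 1) := fun m hm =>
  (Nat.lt_succ_iff_lt_or_eq.1 hm).elim (hb m) fun h => h ▸ hbn

lemma sub_sum_monomial_mem_orderIdeal (b : SkewPowerSeries α) (n : ℕ) :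
    b - ∑ m ∈ Finset.range n, monomial α m (b.coeff m) ∈ orderIdeal α n := fun l hl => by
  simp [coeff_sub, coeff_sum, coeff_monomial, hl]

variable (α) in
/-- Truncation of a skew power series after its first `n` coefficients. -/
def truncation (n : ℕ) : SkewPowerSeries α →ₗ[k] Fin n → D :=
  LinearMap.pi fun i => lcoeff α i

lemma ker_truncation (n : ℕ) :
    LinearMap.ker (truncation α n) = (orderIdeal α n).restrictScalars k := by
  ext b
  exact funext_iff.trans ⟨fun h m hm => h ⟨m, hm⟩, fun h i => h i i.2⟩

lemma truncation_surjective (n : ℕ) : Function.Surjective (truncation α n) := fun v =>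
  ⟨⟨fun m => if h : m < n then v ⟨m, h⟩ else 0⟩, funext fun i => dif_pos i.2⟩

variable (α) in
/-- The quotient of `D[[x, α]]` by the series of order at least `n` is `Dⁿ`. -/
def quotientOrderIdealEquiv (n : ℕ) : (SkewPowerSeries α ⧸ orderIdeal α n) ≃ₗ[k] (Fin n → D) :=
  (Submodule.Quotient.restrictScalarsEquiv k (orderIdeal α n)).symm ≪≫ₗ
    Submodule.quotEquivOfEq _ _ (ker_truncation n).symm ≪≫ₗ
    (truncation α n).quotKerEquivOfSurjective (truncation_surjective n)

instance finiteDimensional_quotient_orderIdeal [FiniteDimensional k D] (n : ℕ) :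
    FiniteDimensional k (SkewPowerSeries α ⧸ orderIdeal α n) :=
  .equiv (quotientOrderIdealEquiv α n).symm

lemma finrank_quotient_orderIdeal [FiniteDimensional k D] (n : ℕ) :
    Module.finrank k (SkewPowerSeries α ⧸ orderIdeal α n) = n * Module.finrank k D := by
  rw [(quotientOrderIdealEquiv α n).finrank_eq, Module.finrank_pi_fintype, Finset.sum_const,
    Finset.card_univ, Fintype.card_fin, smul_eq_mul]

/-! ### Leading coefficients -/

lemma mul_mem_orderIdeal_add {m n : ℕ} {a b : SkewPowerSeries α} (ha : a ∈ orderIdeal α m)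
    (hb : b ∈ orderIdeal α n) : a * b ∈ orderIdeal α (m + n) := fun l hl => by
  rw [coeff_mul]
  refine Finset.sum_eq_zero fun p hp => ?_
  have sum_eq := Finset.HasAntidiagonal.mem_antidiagonal.1 hp
  rcases lt_or_ge p.1 m with h | h
  · rw [ha _ h, zero_mul]
  · rw [hb _ (by lia), map_zero, mul_zero]

lemma coeff_mul_of_mem_orderIdeal {m n : ℕ} {a b : SkewPowerSeries α} (ha : a ∈ orderIdeal α m)
    (hb : b ∈ orderIdeal α n) :
    (a * b).coeff (m + n) = a.coeff m * (α ^ m) (b.coeff n) := by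
  rw [coeff_mul]
  refine Finset.sum_eq_single_of_mem (m, n) (Finset.HasAntidiagonal.mem_antidiagonal.2 rfl)
    fun p hp hp_ne => ?_
  have sum_eq := Finset.HasAntidiagonal.mem_antidiagonal.1 hp
  rcases lt_trichotomy p.1 m with h | h | h
  · rw [ha _ h, zero_mul]
  · exact absurd (Prod.ext h (by lia)) hp_ne
  · rw [hb _ (by lia), map_zero, mul_zero]

lemma exists_mem_orderIdeal_coeff_ne_zero {n : ℕ} {b : SkewPowerSeries α}
    (hb : b ∉ orderIdeal α (n + 1)) : ∃ m ≤ n, b ∈ orderIdeal α m ∧ b.coeff m ≠ 0 := by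
  classical
  have h : ∃ m, b.coeff m ≠ 0 ∧ m ≤ n := by
    simp only [mem_orderIdeal, not_forall] at hb
    obtain ⟨m, hm, hbm⟩ := hb
    exact ⟨m, hbm, Nat.lt_succ_iff.1 hm⟩
  refine ⟨Nat.find h, (Nat.find_spec h).2, fun m hm => ?_, (Nat.find_spec h).1⟩
  by_contra hbm
  exact Nat.find_min h hm ⟨hbm, hm.le.trans (Nat.find_spec h).2⟩

end SkewPowerSeries

namespace SkewPowerSeries

variable {k D : Type*} [Field k] [DivisionRing D] [Algebra k D] {α : D ≃ₐ[k] D}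

lemma exists_sub_mul_mem_orderIdeal {n : ℕ} {b c : SkewPowerSeries α}
    (hb : b ∉ orderIdeal α (n + 1)) (hc : c ∈ orderIdeal α n) :
    ∃ a, c - a * b ∈ orderIdeal α (n + 1) := by
  obtain ⟨m, hmn, hbm, coeff_ne⟩ := exists_mem_orderIdeal_coeff_ne_zero hb
  obtain ⟨l, rfl⟩ := Nat.exists_eq_add_of_le' hmn
  let a := monomial α l (c.coeff (l + m) * ((α ^ l) (b.coeff m))⁻¹)
  have ha : a ∈ orderIdeal α l := monomial_mem_orderIdeal l _
  refine ⟨a, mem_orderIdeal_succ (sub_mem hc (mul_mem_orderIdeal_add ha hbm)) ?_⟩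
  rw [coeff_sub, coeff_mul_of_mem_orderIdeal ha hbm, coeff_monomial_self,
    inv_mul_cancel_right₀ ((map_ne_zero_iff _ (α ^ l).injective).2 coeff_ne), sub_self]

end SkewPowerSeries

namespace SkewPowerSeries

variable {k D : Type*} [Field k] [Ring D] [Algebra k D] {α : D ≃ₐ[k] D}

/-! ### Power series as skew power series -/

variable (k D) in
/-- Power series are skew power series for the identity automorphism. -/
def reflEquiv : SkewPowerSeries (AlgEquiv.refl : D ≃ₐ[k] D) ≃ₐ[k] PowerSeries D :=
  AlgEquiv.ofLinearEquiv
    { toFun := fun b => PowerSeries.mk b.coeff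
      invFun := fun p => ⟨fun n => PowerSeries.coeff n p⟩
      map_add' := fun a b => by ext n; simp
      map_smul' := fun r b => by ext n; simp
      left_inv := fun b => by ext n; simp
      right_inv := fun p => by ext n; simp }
    (by ext n; simp [PowerSeries.coeff_one, coeff_one])
    (fun a b => by
      ext n
      have refl_pow (m : ℕ) : (AlgEquiv.refl : D ≃ₐ[k] D) ^ m = 1 := one_pow m
      simp [PowerSeries.coeff_mul, coeff_mul, refl_pow])

variable (α) in
/-- The inclusion `k[[x]] → D[[x, α]]`; the scalars commute with `x` as `α` is `k`-linear. -/
def ofPowerSeries : PowerSeries k →ₐ[k] SkewPowerSeries α :=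
  AlgHom.ofLinearMap
    { toFun := fun p => ⟨fun n => algebraMap k D (PowerSeries.coeff n p)⟩
      map_add' := fun p q => by ext n; simp
      map_smul' := fun r p => by ext n; simp [coeff_smul, Algebra.smul_def (A := D)] }
    (by
      ext n
      rcases eq_or_ne n 0 with h | h <;> simp [PowerSeries.coeff_one, coeff_one, h])
    (fun p q => by ext n; simp [PowerSeries.coeff_mul, coeff_mul])

lemma ofPowerSeries_X_pow (n : ℕ) : ofPowerSeries α (PowerSeries.X ^ n) = monomial α n 1 := by
  ext m
  rw [coeff_monomial, ← map_one (algebraMap k D), ← map_zero (algebraMap k D), ← apply_ite,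
    ← PowerSeries.coeff_X_pow]
  rfl

lemma not_finiteDimensional_powerSeries (k : Type*) [Field k] :
    ¬ FiniteDimensional k (PowerSeries k) := fun _ =>
  Polynomial.not_finite (Module.Finite.of_injective
    (Polynomial.coeToPowerSeries.algHom (R := k) k).toLinearMap fun p q hpq => by simpa using hpq)

lemma exists_ofPowerSeries_mem (I : Ideal (SkewPowerSeries α))
    [FiniteDimensional k (SkewPowerSeries α ⧸ I)] : ∃ p ≠ 0, ofPowerSeries α p ∈ I := by
  by_contra! h
  let φ : PowerSeries k →ₗ[k] SkewPowerSeries α ⧸ I :=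
    (Submodule.mkQ I).restrictScalars k ∘ₗ (ofPowerSeries α).toLinearMap
  refine not_finiteDimensional_powerSeries k (Module.Finite.of_injective φ ?_)
  refine (injective_iff_map_eq_zero φ).2 fun p hp => ?_
  by_contra hp_ne
  exact h p hp_ne ((Submodule.Quotient.mk_eq_zero I).1 hp)

lemma exists_mul_monomial_one_eq {n : ℕ} {b : SkewPowerSeries α} (hb : b ∈ orderIdeal α n) :
    ∃ a, a * monomial α n 1 = b := by
  let a : SkewPowerSeries α := ⟨fun m => b.coeff (m + n)⟩
  refine ⟨a, SkewPowerSeries.ext (funext fun l => ?_)⟩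
  rcases lt_or_ge l n with hl | hl
  · rw [hb l hl, (orderIdeal α n).mul_mem_left a (monomial_mem_orderIdeal n 1) l hl]
  · obtain ⟨m, rfl⟩ := Nat.exists_eq_add_of_le' hl
    exact coeff_mul_monomial_one a m n

lemma exists_orderIdeal_le (I : Ideal (SkewPowerSeries α))
    [FiniteDimensional k (SkewPowerSeries α ⧸ I)] : ∃ n, orderIdeal α n ≤ I := by
  obtain ⟨p, hp_ne, hp⟩ := exists_ofPowerSeries_mem I
  obtain ⟨n, u, hu⟩ : ∃ (n : ℕ) (u : PowerSeries k), PowerSeries.X ^ n = u * p := by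
    refine ⟨p.order.toNat, PowerSeries.Inv_divided_by_X_pow_order hp_ne, ?_⟩
    refine Eq.trans ?_ (congrArg _ (PowerSeries.X_pow_order_mul_divXPowOrder (f := p)))
    rw [mul_left_comm, PowerSeries.Inv_divided_by_X_pow_order_leftInv, mul_one]
  refine ⟨n, fun b hb => ?_⟩
  obtain ⟨a, rfl⟩ := exists_mul_monomial_one_eq hb
  rw [← ofPowerSeries_X_pow, hu, map_mul]
  exact I.mul_mem_left _ (I.mul_mem_left _ hp)

end SkewPowerSeries

/-! ### Coalgebra maps to finite duals -/

section FiniteQuotient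

variable {k A B : Type*} [Field k] [Ring A] [Algebra k A] [Ring B] [Algebra k B]

lemma finiteDimensional_quotient_comap (φ : A →ₐ[k] B) (I : Ideal B)
    [FiniteDimensional k (B ⧸ I)] : FiniteDimensional k (A ⧸ I.comap φ) := by
  let ψ : A →ₗ[k] B ⧸ I := (Submodule.mkQ I).restrictScalars k ∘ₗ φ.toLinearMap
  have ker_eq : LinearMap.ker ψ = (I.comap φ).restrictScalars k := by
    ext a
    exact Submodule.Quotient.mk_eq_zero I
  have : FiniteDimensional k (A ⧸ LinearMap.ker ψ) := .equiv ψ.quotKerEquivRange.symm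
  rw [ker_eq] at this
  exact .equiv (Submodule.Quotient.restrictScalarsEquiv k (I.comap φ))

lemma finrank_quotient_le_finrank_coidealSpan {C : Type*} [AddCommGroup C] [Module k C]
    [Coalgebra k C] (φ : A →ₐ[k] DualAlgebra k C) (c : C) {I : Ideal A}
    (h : ∀ b, (∀ a, φ (a * b) c = 0) → b ∈ I) :
    Module.finrank k (A ⧸ I) ≤ Module.finrank k (coidealSpan k c) := by
  let ψ : A →ₗ[k] coidealSpan k c :=
    (leftAct.flip c).rangeRestrict ∘ₗ φ.toLinearMap
  have ker_le : LinearMap.ker ψ ≤ I.restrictScalars k := fun b hb => h b fun a => by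
    have leftAct_eq_zero : leftAct (φ b) c = 0 := congrArg Subtype.val hb
    rw [map_mul, ← apply_leftAct, leftAct_eq_zero, map_zero]
  have : FiniteDimensional k (A ⧸ LinearMap.ker ψ) := .equiv ψ.quotKerEquivRange.symm
  calc Module.finrank k (A ⧸ I)
      = Module.finrank k (A ⧸ I.restrictScalars k) :=
        (Submodule.Quotient.restrictScalarsEquiv k I).finrank_eq.symm
    _ ≤ Module.finrank k (A ⧸ LinearMap.ker ψ) :=
        LinearMap.finrank_le_finrank_of_surjective (Submodule.factor_surjective ker_le)
    _ = Module.finrank k (LinearMap.range ψ) := ψ.quotKerEquivRange.finrank_eq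
    _ ≤ Module.finrank k (coidealSpan k c) := Submodule.finrank_le _

end FiniteQuotient

namespace finiteDual

variable {k A B : Type*} [Field k] [Ring A] [Algebra k A] [Ring B] [Algebra k B]

lemma comp_mem (φ : A →ₐ[k] B) {f : Module.Dual k B} (hf : f ∈ finiteDual k B) :
    f ∘ₗ φ.toLinearMap ∈ finiteDual k A := by
  obtain ⟨I, hI, hI', hfI⟩ := hf
  exact ⟨I.comap φ, ⟨fun b ha => by rw [Ideal.mem_comap, map_mul]; exact I.mul_mem_right _ ha⟩,
    finiteDimensional_quotient_comap φ I, fun a ha => hfI _ ha⟩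

/-- Evaluation at `a`, as a functional on `A°`. -/
def evalAt : A →ₗ[k] DualAlgebra k (finiteDual k A) where
  toFun a := WithConv.toConv (LinearMap.proj a ∘ₗ ev k A)
  map_add' a b := by ext f; exact map_add f.1 a b
  map_smul' r a := by ext f; exact map_smul f.1 r a

lemma pairing_apply (u : finiteDual k A ⊗[k] finiteDual k A) (a b : A) :
    pairing k A u (a, b) =
      LinearMap.mul' k k (TensorProduct.map (evalAt a).ofConv (evalAt b).ofConv u) := by
  induction u using TensorProduct.induction_on with
  | zero => simp
  | tmul f g => rfl
  | add u v hu hv => simp only [map_add, Pi.add_apply, hu, hv]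

variable (k A) in
/-- The canonical algebra map `A → (A°)*`. -/
def evalHom : A →ₐ[k] DualAlgebra k (finiteDual k A) :=
  AlgHom.ofLinearMap evalAt rfl fun a b => by
    ext f
    exact (pairing_comul k A f (a, b)).symm.trans (pairing_apply _ a b)

lemma evalHom_apply (a : A) (f : finiteDual k A) : evalHom k A a f = f.1 a := rfl

lemma rightAct_evalHom_apply (a b : A) (f : finiteDual k A) :
    (rightAct (evalHom k A a) f).1 b = f.1 (a * b) := by
  rw [← evalHom_apply, apply_rightAct, ← map_mul, evalHom_apply]

section CoalgHom

variable {C : Type*} [AddCommGroup C] [Module k C] [Coalgebra k C]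

/-- The transpose `C → A*` of a linear map `A → C*`. -/
def transpose (φ : A →ₗ[k] DualAlgebra k C) : C →ₗ[k] Module.Dual k A :=
  ((WithConv.linearEquiv k (C →ₗ[k] k)).toLinearMap ∘ₗ φ).flip

/-- The transpose of an algebra map `A → C*`, as a coalgebra map `C → A°`. -/
def coalgHom (φ : A →ₐ[k] DualAlgebra k C)
    (hφ : ∀ c, transpose φ.toLinearMap c ∈ finiteDual k A) : C →ₗc[k] finiteDual k A where
  __ := (transpose φ.toLinearMap).codRestrict _ hφ
  counit_comp := LinearMap.ext fun c => congrArg (fun f : DualAlgebra k C => f c) (map_one φ)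
  map_comp_comul := by
    refine LinearMap.ext fun c => pairing_injective k A (funext fun ⟨a, b⟩ => ?_)
    let ψ := (transpose φ.toLinearMap).codRestrict _ hφ
    have evalAt_comp (a : A) : (evalAt a).ofConv ∘ₗ ψ = (φ a).ofConv := rfl
    change pairing k A (TensorProduct.map ψ ψ (Coalgebra.comul c)) (a, b) =
      pairing k A (comul k A (ψ c)) (a, b)
    rw [pairing_apply, TensorProduct.map_map, evalAt_comp, evalAt_comp, pairing_comul]
    change (φ a * φ b) c = φ (a * b) c
    rw [map_mul]

lemma coalgHom_apply {φ : A →ₐ[k] DualAlgebra k C}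
    {hφ : ∀ c, transpose φ.toLinearMap c ∈ finiteDual k A} (c : C) (a : A) :
    (coalgHom φ hφ c).1 a = φ a c := rfl

/-- Isomorphic algebras have isomorphic finite duals. -/
def congr (e : A ≃ₐ[k] B) : finiteDual k A ≃ₗc[k] finiteDual k B :=
  CoalgEquiv.ofCoalgHom
    (coalgHom ((evalHom k A).comp e.symm.toAlgHom) fun f => comp_mem e.symm.toAlgHom f.2)
    (coalgHom ((evalHom k B).comp e.toAlgHom) fun f => comp_mem e.toAlgHom f.2)
    (CoalgHom.ext fun f => Subtype.ext (LinearMap.ext fun b =>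
      congrArg f.1 (e.apply_symm_apply b)))
    (CoalgHom.ext fun f => Subtype.ext (LinearMap.ext fun a =>
      congrArg f.1 (e.symm_apply_apply a)))

end CoalgHom

/-! ### Cocommutativity -/

lemma pairing_comm (u : finiteDual k A ⊗[k] finiteDual k A) (a b : A) :
    pairing k A (TensorProduct.comm k _ _ u) (a, b) = pairing k A u (b, a) := by
  induction u using TensorProduct.induction_on with
  | zero => simp
  | tmul f g => exact mul_comm _ _
  | add u v hu hv => simp only [map_add, Pi.add_apply, hu, hv]

instance isCocomm {A : Type*} [CommRing A] [Algebra k A] :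
    Coalgebra.IsCocomm k (finiteDual k A) where
  comm_comp_comul := LinearMap.ext fun f => pairing_injective k A <| funext fun ⟨a, b⟩ => by
    refine (pairing_comm _ a b).trans ((pairing_comul k A f (b, a)).trans ?_)
    rw [mul_comm]
    exact (pairing_comul k A f (a, b)).symm

lemma apply_mul_comm [Coalgebra.IsCocomm k (finiteDual k A)] (f : finiteDual k A) (a b : A) :
    f.1 (a * b) = f.1 (b * a) := by
  rw [← evalHom_apply, ← evalHom_apply, map_mul, map_mul, mul_comm]

end finiteDual

lemma isCocomm_of_coalgEquiv {k C D : Type*} [CommSemiring k] [AddCommMonoid C] [Module k C]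
    [Coalgebra k C] [AddCommMonoid D] [Module k D] [Coalgebra k D] [Coalgebra.IsCocomm k C]
    (e : C ≃ₗc[k] D) : Coalgebra.IsCocomm k D where
  comm_comp_comul := LinearMap.ext fun d => by
    obtain ⟨c, rfl⟩ := e.surjective d
    have comul_map : Coalgebra.comul (e.toLinearEquiv c) =
        TensorProduct.map e.toLinearMap e.toLinearMap (Coalgebra.comul (R := k) c) :=
      (LinearMap.congr_fun e.map_comp_comul c).symm
    rw [LinearMap.comp_apply, comul_map, LinearEquiv.coe_coe, ← TensorProduct.map_comm,
      Coalgebra.comm_comul]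

namespace finiteDual

variable {k A : Type*} [Field k] [Ring A] [Algebra k A]

/-! ### Forms vanishing on an ideal -/

/-- The forms in the finite dual that vanish on an ideal. -/
def vanishingOn (k : Type*) {A : Type*} [Field k] [Ring A] [Algebra k A] (I : Ideal A) :
    Submodule k (finiteDual k A) :=
  (I.restrictScalars k).dualAnnihilator.comap (finiteDual k A).subtype

lemma mem_vanishingOn {I : Ideal A} {f : finiteDual k A} :
    f ∈ vanishingOn k I ↔ ∀ a ∈ I, f.1 a = 0 :=
  Submodule.mem_dualAnnihilator _

lemma vanishingOn_antitone : Antitone (vanishingOn k (A := A)) := fun _ _ h _ hf =>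
  mem_vanishingOn.2 fun a ha => mem_vanishingOn.1 hf a (h ha)

lemma vanishingOn_top : vanishingOn k (⊤ : Ideal A) = ⊥ :=
  eq_bot_iff.2 fun _ hf => Subtype.ext (LinearMap.ext fun a => mem_vanishingOn.1 hf a trivial)

lemma isRightCoideal_vanishingOn (I : Ideal A) [I.IsTwoSided] :
    IsRightCoideal k (C := finiteDual k A) (vanishingOn k I) := by
  refine (isRightCoideal_iff _).2 fun g f hf => mem_vanishingOn.2 fun a ha => ?_
  have rightAct_eq_zero : rightAct (evalHom k A a) f = 0 :=
    Subtype.ext <| LinearMap.ext fun b => by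
      rw [rightAct_evalHom_apply]
      exact mem_vanishingOn.1 hf _ (I.mul_mem_right b ha)
  rw [← evalHom_apply, apply_leftAct, ← apply_rightAct, rightAct_eq_zero, map_zero]

section FiniteCodimension

variable (k) (I : Ideal A) [I.IsTwoSided] [FiniteDimensional k (A ⧸ I)]

lemma dualAnnihilator_le_finiteDual : (I.restrictScalars k).dualAnnihilator ≤ finiteDual k A :=
  fun f hf => ⟨I, inferInstance, inferInstance, fun a ha =>
    (Submodule.mem_dualAnnihilator f).1 hf a ha⟩

/-- The forms in `A°` that vanish on `I` form the dual of `A / I`. -/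
def vanishingOnEquivDualQuotient : vanishingOn k I ≃ₗ[k] Module.Dual k (A ⧸ I) :=
  Submodule.comapSubtypeEquivOfLe (dualAnnihilator_le_finiteDual k I) ≪≫ₗ
    (I.restrictScalars k).dualQuotEquivDualAnnihilator.symm ≪≫ₗ
    (Submodule.Quotient.restrictScalarsEquiv k I).symm.dualMap

instance finite_vanishingOn : Module.Finite k (vanishingOn k I) :=
  .equiv (vanishingOnEquivDualQuotient k I).symm

lemma finrank_vanishingOn : Module.finrank k (vanishingOn k I) = Module.finrank k (A ⧸ I) := by
  rw [(vanishingOnEquivDualQuotient k I).finrank_eq, Subspace.dual_finrank_eq]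

variable {k I}

lemma mem_of_forall_mem_vanishingOn {a : A} (h : ∀ f ∈ vanishingOn k I, f.1 a = 0) : a ∈ I :=
  (Subspace.forall_mem_dualAnnihilator_apply_eq_zero_iff (I.restrictScalars k) a).1 fun f hf =>
    h ⟨f, dualAnnihilator_le_finiteDual k I hf⟩ hf

lemma vanishingOn_le {P : Submodule k (finiteDual k A)}
    (hP : IsRightCoideal k (C := finiteDual k A) P) {f : finiteDual k A} (hfP : f ∈ P)
    (hfI : f ∈ vanishingOn k I) (h : ∀ b, (∀ a, f.1 (a * b) = 0) → b ∈ I) :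
    vanishingOn k I ≤ P := by
  have coidealSpan_eq : coidealSpan k f = vanishingOn k I := by
    refine Submodule.eq_of_le_of_finrank_le (V := finiteDual k A)
      ((isRightCoideal_vanishingOn I).coidealSpan_le hfI) ?_
    rw [finrank_vanishingOn]
    exact finrank_quotient_le_finrank_coidealSpan (evalHom k A) f h
  exact coidealSpan_eq ▸ hP.coidealSpan_le hfP

end FiniteCodimension

end finiteDual

/-! ### The finite dual of a skew power series ring -/

namespace SkewPowerSeries

open finiteDual

lemma exists_mem_vanishingOn_orderIdeal {k D : Type*} [Field k] [Ring D] [Algebra k D]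
    {α : D ≃ₐ[k] D} (f : finiteDual k (SkewPowerSeries α)) :
    ∃ n, f ∈ vanishingOn k (orderIdeal α n) := by
  obtain ⟨f, I, hI, hI', hf⟩ := f
  obtain ⟨n, hn⟩ := exists_orderIdeal_le (k := k) I
  exact ⟨n, mem_vanishingOn.2 fun b hb => hf b (hn hb)⟩

lemma vanishingOn_orderIdeal_zero {k D : Type*} [Field k] [Ring D] [Algebra k D]
    (α : D ≃ₐ[k] D) : vanishingOn k (orderIdeal α 0) = ⊥ := by
  rw [orderIdeal_zero, vanishingOn_top]

variable {k D : Type*} [Field k] [DivisionRing D] [Algebra k D] [FiniteDimensional k D]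
  (α : D ≃ₐ[k] D)

lemma finrank_vanishingOn_orderIdeal (n : ℕ) :
    Module.finrank k (vanishingOn k (orderIdeal α n)) = n * Module.finrank k D := by
  rw [finrank_vanishingOn, finrank_quotient_orderIdeal]

lemma vanishingOn_orderIdeal_lt_succ (n : ℕ) :
    vanishingOn k (orderIdeal α n) < vanishingOn k (orderIdeal α (n + 1)) := by
  refine lt_of_le_of_ne (vanishingOn_antitone (orderIdeal_antitone n.le_succ)) fun h => ?_
  have finrank_eq := finrank_vanishingOn_orderIdeal α n
  rw [h, finrank_vanishingOn_orderIdeal, Nat.succ_mul] at finrank_eq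
  have := Module.finrank_pos (R := k) (M := D)
  lia

lemma vanishingOn_orderIdeal_le {α : D ≃ₐ[k] D} {P : Submodule k (finiteDual k (SkewPowerSeries α))}
    (hP : IsRightCoideal k (C := finiteDual k (SkewPowerSeries α)) P)
    {f : finiteDual k (SkewPowerSeries α)} (hfP : f ∈ P) {m : ℕ}
    (hf : f ∈ vanishingOn k (orderIdeal α (m + 1))) (hf' : f ∉ vanishingOn k (orderIdeal α m)) :
    vanishingOn k (orderIdeal α (m + 1)) ≤ P := by
  refine vanishingOn_le hP hfP hf fun b hb => ?_
  by_contra hbm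
  refine hf' (mem_vanishingOn.2 fun c hc => ?_)
  obtain ⟨a, ha⟩ := exists_sub_mul_mem_orderIdeal hbm hc
  rw [← sub_add_cancel c (a * b), map_add, hb, mem_vanishingOn.1 hf _ ha, add_zero]

lemma isNextCoideal_vanishingOn_orderIdeal (n : ℕ) :
    IsNextCoideal (C := finiteDual k (SkewPowerSeries α))
      (vanishingOn k (orderIdeal α n)) (vanishingOn k (orderIdeal α (n + 1))) where
  isRightCoideal := isRightCoideal_vanishingOn _
  finiteDimensional := inferInstanceAs (Module.Finite k (vanishingOn k (orderIdeal α (n + 1))))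
  lt := vanishingOn_orderIdeal_lt_succ α n
  le_of_not_le P hP h := by
    classical
    obtain ⟨f, hfP, hfn⟩ := SetLike.not_le_iff_exists.1 h
    have exists_mem := exists_mem_vanishingOn_orderIdeal f
    have lt_find : n < Nat.find exists_mem := (Nat.lt_find_iff _ n).2 fun m hm hfm =>
      hfn (vanishingOn_antitone (orderIdeal_antitone hm) hfm)
    obtain ⟨m, hm⟩ := Nat.exists_eq_succ_of_ne_zero (Nat.ne_zero_of_lt lt_find)
    have mem_succ := Nat.find_spec exists_mem
    rw [hm] at mem_succ
    exact (vanishingOn_antitone (orderIdeal_antitone (by lia))).trans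
      (vanishingOn_orderIdeal_le hP hfP mem_succ (Nat.find_min exists_mem (by lia)))

lemma isSmallestCoideal_vanishingOn_orderIdeal :
    IsSmallestCoideal (C := finiteDual k (SkewPowerSeries α)) (vanishingOn k (orderIdeal α 1)) := by
  have isNextCoideal := isNextCoideal_vanishingOn_orderIdeal α 0
  rwa [vanishingOn_orderIdeal_zero] at isNextCoideal

theorem isChainCoalgebra_finiteDual : IsChainCoalgebra k (finiteDual k (SkewPowerSeries α)) :=
  isChainCoalgebra_of_isNextCoideal (fun n => vanishingOn k (orderIdeal α n))
    (vanishingOn_orderIdeal_zero α) (isNextCoideal_vanishingOn_orderIdeal α)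
    exists_mem_vanishingOn_orderIdeal

lemma not_finiteDimensional_finiteDual :
    ¬ FiniteDimensional k (finiteDual k (SkewPowerSeries α)) := fun _ => by
  let d := Module.finrank k (finiteDual k (SkewPowerSeries α))
  have finrank_le : (d + 1) * Module.finrank k D ≤ d := by
    rw [← finrank_vanishingOn_orderIdeal α (d + 1)]
    exact Submodule.finrank_le _
  have := Nat.le_mul_of_pos_right (d + 1) (Module.finrank_pos (R := k) (M := D))
  lia

end SkewPowerSeries

/-! ### Evaluation of skew power series in a dual algebra -/

namespace DualAlgebra

variable {k C : Type*} [Field k] [AddCommGroup C] [Module k C] [Coalgebra k C]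
  {ι : Type*} {l : Filter ι} {S : ι → Set (DualAlgebra k C)}

lemma eventually_mul_apply_eq_zero (hS : ∀ c, ∀ᶠ i in l, ∀ g ∈ S i, g c = 0) (c : C) :
    ∀ᶠ i in l, ∀ g ∈ S i, ∀ f : DualAlgebra k C, (f * g) c = 0 := by
  let r := Coalgebra.Repr.arbitrary k c
  filter_upwards [(Filter.eventually_all_finset r.index).2 fun j _ => hS (r.right j)]
    with i hi g hg f
  rw [r.convMul_apply]
  exact Finset.sum_eq_zero fun j hj => by rw [hi j hj g hg, mul_zero]

lemma eventually_mul_apply_eq_zero' (hS : ∀ c, ∀ᶠ i in l, ∀ g ∈ S i, g c = 0) (c : C) :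
    ∀ᶠ i in l, ∀ g ∈ S i, ∀ f : DualAlgebra k C, (g * f) c = 0 := by
  let r := Coalgebra.Repr.arbitrary k c
  filter_upwards [(Filter.eventually_all_finset r.index).2 fun j _ => hS (r.left j)]
    with i hi g hg f
  rw [r.convMul_apply]
  exact Finset.sum_eq_zero fun j hj => by rw [hi j hj g hg, zero_mul]

namespace IsPointwiseNilpotent

variable {x : DualAlgebra k C} (hx : x.IsPointwiseNilpotent)

include hx

lemma eventually_forall_mul_pow_apply_eq_zero (c : C) :
    ∀ᶠ n in Filter.atTop, ∀ m ≥ n, ∀ f : DualAlgebra k C, (f * x ^ m) c = 0 := by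
  rw [Filter.eventually_forall_ge_atTop]
  have kills (d : C) : ∀ᶠ m in Filter.atTop, ∀ g ∈ ({x ^ m} : Set (DualAlgebra k C)), g d = 0 :=
    (hx d).mono fun m hm g hg => hg ▸ hm
  exact (eventually_mul_apply_eq_zero kills c).mono fun m hm => hm _ rfl

lemma finite_support_mul_pow_apply (f : ℕ → DualAlgebra k C) (c : C) :
    (Function.support fun m => (f m * x ^ m) c).Finite := by
  obtain ⟨n, hn⟩ := (hx.eventually_forall_mul_pow_apply_eq_zero c).exists
  refine (Set.finite_Iio n).subset fun m hm => ?_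
  by_contra h
  exact hm (hn m (not_lt.1 h) (f m))

end IsPointwiseNilpotent

end DualAlgebra

lemma mul_eq_mul_add_sub_mul_add {R : Type*} [Ring R] (u v u' v' : R) :
    u * v = u' * v' + ((u - u') * v + u' * (v - v')) := by
  noncomm_ring

namespace SkewPowerSeries

variable {k C D : Type*} [Field k] [AddCommGroup C] [Module k C] [Coalgebra k C] [Ring D]
  [Algebra k D] {α : D ≃ₐ[k] D} {x : DualAlgebra k C}

variable (α) in
/-- The linear map `∑ aₘ xᵐ ↦ ∑ φ(aₘ) xᵐ` to a dual algebra, for a pointwise nilpotent `x`; on each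
element of the coalgebra only finitely many terms are nonzero. -/
def evalLinear (φ : D →ₐ[k] DualAlgebra k C) (hx : x.IsPointwiseNilpotent) :
    SkewPowerSeries α →ₗ[k] DualAlgebra k C :=
  (WithConv.linearEquiv k (C →ₗ[k] k)).symm.toLinearMap ∘ₗ
    LinearMap.mk₂ k (fun b c => ∑ᶠ m, (φ (b.coeff m) * x ^ m) c)
      (fun a b c => by
        rw [← finsum_add_distrib (hx.finite_support_mul_pow_apply _ c)
          (hx.finite_support_mul_pow_apply _ c)]
        exact finsum_congr fun m => by rw [coeff_add, map_add, add_mul]; rfl)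
      (fun r b c => by
        refine (finsum_congr fun m => ?_).trans (smul_finsum r _).symm
        rw [coeff_smul, map_smul, smul_mul_assoc]
        rfl)
      (fun b c d => by
        rw [← finsum_add_distrib (hx.finite_support_mul_pow_apply _ c)
          (hx.finite_support_mul_pow_apply _ d)]
        exact finsum_congr fun m => map_add (φ (b.coeff m) * x ^ m).ofConv c d)
      (fun r b c => (finsum_congr fun m => map_smul (φ (b.coeff m) * x ^ m).ofConv r c).trans
        (smul_finsum r _).symm)

variable {φ : D →ₐ[k] DualAlgebra k C} (hx : x.IsPointwiseNilpotent)

lemma evalLinear_monomial (m : ℕ) (w : D) :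
    evalLinear α φ hx (monomial α m w) = φ w * x ^ m := by
  ext c
  refine (finsum_eq_single _ m fun n hn => ?_).trans (by rw [coeff_monomial_self])
  rw [coeff_monomial, if_neg hn, map_zero, zero_mul]
  rfl

lemma eventually_evalLinear_apply_eq_zero (c : C) :
    ∀ᶠ n in Filter.atTop, ∀ g ∈ evalLinear α φ hx '' orderIdeal α n, g c = 0 := by
  filter_upwards [hx.eventually_forall_mul_pow_apply_eq_zero c] with n hn
  rintro _ ⟨b, hb, rfl⟩
  refine finsum_eq_zero_of_forall_eq_zero fun m => ?_
  rcases lt_or_ge m n with h | h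
  · rw [hb m h, map_zero, zero_mul]
    rfl
  · exact hn m h _

section Multiplicative

variable (h : ∀ w, SemiconjBy x (φ w) (φ (α w)))

include h

lemma semiconjBy_pow (m : ℕ) (w : D) : SemiconjBy (x ^ m) (φ w) (φ ((α ^ m) w)) := by
  induction m with
  | zero => simp
  | succ m ih =>
    rw [pow_succ', pow_succ' α]
    exact (h _).mul_left ih

lemma evalLinear_monomial_mul_monomial (m n : ℕ) (v w : D) :
    evalLinear α φ hx (monomial α m v * monomial α n w) =
      evalLinear α φ hx (monomial α m v) * evalLinear α φ hx (monomial α n w) := by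
  rw [monomial_mul_monomial, evalLinear_monomial, evalLinear_monomial, evalLinear_monomial,
    map_mul, pow_add, mul_assoc, mul_assoc, ← mul_assoc (x ^ m), (semiconjBy_pow h m w).eq,
    mul_assoc]

lemma evalLinear_mul (a b : SkewPowerSeries α) :
    evalLinear α φ hx (a * b) = evalLinear α φ hx a * evalLinear α φ hx b := by
  ext c
  have kills := eventually_evalLinear_apply_eq_zero (φ := φ) (α := α) hx
  obtain ⟨n, hn, left_kill, right_kill⟩ := ((kills c).and
    ((eventually_mul_apply_eq_zero kills c).and (eventually_mul_apply_eq_zero' kills c))).exists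
  let trunc (b : SkewPowerSeries α) := ∑ m ∈ Finset.range n, monomial α m (b.coeff m)
  have sub_trunc (b : SkewPowerSeries α) : b - trunc b ∈ orderIdeal α n :=
    sub_sum_monomial_mem_orderIdeal b n
  have mul_trunc : evalLinear α φ hx (trunc a * trunc b) =
      evalLinear α φ hx (trunc a) * evalLinear α φ hx (trunc b) := by
    simp only [trunc, Finset.sum_mul_sum, map_sum, evalLinear_monomial_mul_monomial hx h]
  rw [mul_eq_mul_add_sub_mul_add a b (trunc a) (trunc b), mul_eq_mul_add_sub_mul_add
    (evalLinear α φ hx a) _ (evalLinear α φ hx (trunc a)) (evalLinear α φ hx (trunc b)),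
    ← mul_trunc, map_add, ← map_sub, ← map_sub]
  have mem : (a - trunc a) * b + trunc a * (b - trunc b) ∈ orderIdeal α n :=
    add_mem ((orderIdeal α n).mul_mem_right _ (sub_trunc a))
      ((orderIdeal α n).mul_mem_left _ (sub_trunc b))
  refine congrArg (evalLinear α φ hx (trunc a * trunc b) c + ·) ((hn _ ⟨_, mem, rfl⟩).trans ?_)
  refine Eq.symm ((congrArg₂ (· + ·) ?_ ?_).trans (add_zero (0 : k)))
  · exact right_kill _ ⟨_, sub_trunc a, rfl⟩ _
  · exact left_kill _ ⟨_, sub_trunc b, rfl⟩ _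

/-- The algebra map `∑ aₘ xᵐ ↦ ∑ φ(aₘ) xᵐ` from `D[[x, α]]` to a dual algebra. -/
def eval : SkewPowerSeries α →ₐ[k] DualAlgebra k C :=
  AlgHom.ofLinearMap (evalLinear α φ hx)
    (by rw [one_eq_monomial, evalLinear_monomial, map_one, pow_zero, one_mul])
    (evalLinear_mul hx h)

lemma eval_monomial (m : ℕ) (w : D) : eval hx h (monomial α m w) = φ w * x ^ m :=
  evalLinear_monomial hx m w

lemma commute_eval {g : DualAlgebra k C} (hgφ : ∀ w, Commute g (φ w)) (hgx : Commute g x)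
    (b : SkewPowerSeries α) : Commute g (eval hx h b) := by
  ext c
  have kills := eventually_evalLinear_apply_eq_zero (φ := φ) (α := α) hx
  obtain ⟨n, left_kill, right_kill⟩ :=
    ((eventually_mul_apply_eq_zero kills c).and (eventually_mul_apply_eq_zero' kills c)).exists
  let trunc := ∑ m ∈ Finset.range n, monomial α m (b.coeff m)
  have sub_trunc : eval hx h (b - trunc) ∈ evalLinear α φ hx '' orderIdeal α n :=
    ⟨_, sub_sum_monomial_mem_orderIdeal b n, rfl⟩
  have commute_trunc : Commute g (eval hx h trunc) := by
    rw [map_sum]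
    refine Commute.sum_right _ _ _ fun m _ => ?_
    rw [eval_monomial]
    exact (hgφ _).mul_right (hgx.pow_right m)
  rw [← sub_add_cancel b trunc, map_add, mul_add, add_mul, commute_trunc.eq]
  exact congrArg (· + _) ((left_kill _ sub_trunc g).trans (right_kill _ sub_trunc g).symm)

lemma transpose_eval_mem_finiteDual [FiniteDimensional k D] (c : C) :
    finiteDual.transpose (eval hx h).toLinearMap c ∈ finiteDual k (SkewPowerSeries α) := by
  obtain ⟨n, hn⟩ := (eventually_evalLinear_apply_eq_zero (α := α) (φ := φ) hx c).exists
  exact ⟨orderIdeal α n, inferInstance, inferInstance, fun b hb => hn _ ⟨b, hb, rfl⟩⟩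

end Multiplicative

end SkewPowerSeries

section Recognition

variable {k C : Type*} [Field k] [AddCommGroup C] [Module k C] [Coalgebra k C]
  {x : DualAlgebra k C}

lemma DualAlgebra.IsPointwiseNilpotent.exists_rightAct_pow_eq_zero (hx : x.IsPointwiseNilpotent)
    (c : C) : ∃ m, rightAct (x ^ m) c = 0 := by
  have kills (d : C) : ∀ᶠ m in Filter.atTop, ∀ g ∈ ({x ^ m} : Set (DualAlgebra k C)), g d = 0 :=
    (hx d).mono fun m hm g hg => hg ▸ hm
  obtain ⟨m, hm⟩ := (eventually_mul_apply_eq_zero' kills c).exists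
  exact ⟨m, ext_of_forall_apply fun f => by rw [apply_rightAct, hm _ rfl, map_zero]⟩

variable {D : Type*} [Ring D] [Algebra k D] [FiniteDimensional k D] {α : D ≃ₐ[k] D}
  {φ : D →ₐ[k] DualAlgebra k C} {S T : Submodule k C}

lemma IsNextCoideal.coalgHom_eval_injective (hT : IsNextCoideal S T) (hS' : IsSubcoalgebra S)
    (hT' : IsSubcoalgebra T) (hφ : ∀ f, ∃ w, f - φ w ∈ hS'.annihilator)
    (hx : x.IsPointwiseNilpotent) (hxT : x ∉ hT'.annihilator)
    (h : ∀ w, SemiconjBy x (φ w) (φ (α w))) :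
    Function.Injective (finiteDual.coalgHom (SkewPowerSeries.eval hx h)
      (SkewPowerSeries.transpose_eval_mem_finiteDual hx h)) := by
  refine (injective_iff_map_eq_zero _).2 fun c hc => ?_
  have mul_pow_apply (w : D) (m : ℕ) : (φ w * x ^ m) c = 0 := by
    rw [← SkewPowerSeries.eval_monomial hx h, ← finiteDual.coalgHom_apply
      (hφ := SkewPowerSeries.transpose_eval_mem_finiteDual hx h), hc]
    rfl
  have eq_zero_of_rightAct_pow (m : ℕ) (hm : rightAct (x ^ m) c = 0) : c = 0 := by
    induction m with
    | zero => rwa [pow_zero, rightAct_one] at hm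
    | succ m ih =>
      rw [pow_succ, rightAct_mul] at hm
      refine ih (ext_of_forall_apply (k := k) fun f => ?_)
      obtain ⟨w, hw⟩ := hφ f
      have apply_eq : f (rightAct (x ^ m) c) = φ w (rightAct (x ^ m) c) :=
        sub_eq_zero.1 (hw _ (hT.ker_rightAct_le hT' hxT hm))
      rw [apply_eq, apply_rightAct, (SkewPowerSeries.semiconjBy_pow h m w).eq, mul_pow_apply,
        map_zero]
  obtain ⟨m, hm⟩ := hx.exists_rightAct_pow_eq_zero c
  exact eq_zero_of_rightAct_pow m hm

end Recognition

theorem IsNextCoideal.nonempty_coalgEquiv_finiteDual {k C D : Type*} [Field k] [AddCommGroup C]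
    [Module k C] [Coalgebra k C] (hC : ¬ FiniteDimensional k C) [DivisionRing D] [Algebra k D]
    [FiniteDimensional k D] {α : D ≃ₐ[k] D} {φ : D →ₐ[k] DualAlgebra k C} {S T : Submodule k C}
    (hT : IsNextCoideal S T) (hS' : IsSubcoalgebra S) (hT' : IsSubcoalgebra T)
    (hφ : ∀ f, ∃ w, f - φ w ∈ hS'.annihilator) {x : DualAlgebra k C}
    (hx : x.IsPointwiseNilpotent) (hxT : x ∉ hT'.annihilator)
    (h : ∀ w, SemiconjBy x (φ w) (φ (α w))) :
    Nonempty (C ≃ₗc[k] finiteDual k (SkewPowerSeries α)) :=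
  ⟨CoalgEquiv.ofBijective <| (SkewPowerSeries.isChainCoalgebra_finiteDual α).bijective_of_injective
    hC _ (hT.coalgHom_eval_injective hS' hT' hφ hx hxT h)⟩

/-! ### Averaging over a square root of `-1` -/

section Averaging

variable {R : Type*} [Ring R] {i j : R}

lemma commute_sub_mul_mul (hi : i * i = -1) (a : R) : Commute (a - i * a * i) i := by
  have mul_mul_self (u : R) : i * (i * u) = -u := by rw [← mul_assoc, hi, neg_one_mul]
  simp only [commute_iff_eq, sub_mul, mul_sub, mul_assoc, mul_mul_self, hi, mul_neg, mul_one]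
  abel

lemma semiconjBy_add_mul_mul (hi : i * i = -1) (a : R) : SemiconjBy (a + i * a * i) i (-i) := by
  have mul_mul_self (u : R) : i * (i * u) = -u := by rw [← mul_assoc, hi, neg_one_mul]
  simp only [SemiconjBy, add_mul, mul_add, mul_assoc, mul_mul_self, hi, mul_neg, mul_one, neg_mul]
  abel

lemma semiconjBy_neg_symm (h : SemiconjBy i j (-j)) : SemiconjBy j i (-i) := by
  rw [SemiconjBy, neg_mul, h.eq, neg_mul, neg_neg]

lemma commute_mul_of_semiconjBy_neg {u v : R} (hu : SemiconjBy u i (-i))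
    (hv : SemiconjBy v i (-i)) : Commute (u * v) i := by
  have := hu.neg_right.mul_left hv
  rwa [neg_neg] at this

end Averaging

section Quaternion

variable {A : Type*} [Ring A] [Algebra ℝ A] {i j u : A}

lemma eq_zero_of_commute_of_semiconjBy_neg (hi : i * i = -1) (hu : Commute u i)
    (hu' : SemiconjBy u i (-i)) : u = 0 := by
  have : IsAddTorsionFree A := .of_isTorsionFree ℝ A
  have mul_eq_zero : i * u = 0 := self_eq_neg.1 (by rw [← neg_mul, ← hu'.eq, hu.eq])
  rw [← neg_eq_zero, ← neg_one_mul, ← hi, mul_assoc, mul_eq_zero, mul_zero]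

/-- The homomorphism from the real quaternions given by two anticommuting square roots of `-1`. -/
def quaternionLift (hi : i * i = -1) (hj : j * j = -1) (hij : SemiconjBy j i (-i)) :
    Quaternion ℝ →ₐ[ℝ] A :=
  QuaternionAlgebra.Basis.liftHom
    { i := i
      j := j
      k := i * j
      i_mul_i := by simp [hi]
      j_mul_j := by simp [hj]
      i_mul_j := rfl
      j_mul_i := by simp [hij.eq] }

lemma quaternionLift_apply (hi : i * i = -1) (hj : j * j = -1) (hij : SemiconjBy j i (-i))
    (q : Quaternion ℝ) : quaternionLift hi hj hij q =
      algebraMap ℝ A q.re + q.imI • i + q.imJ • j + q.imK • (i * j) :=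
  rfl

end Quaternion

/-! ### Frobenius' theorem on real division algebras -/

section Frobenius

variable {D : Type*} [Ring D] [IsDomain D] [Algebra ℝ D] [FiniteDimensional ℝ D]

lemma mem_range_liftAux_of_commute {i a : D} (hi : i * i = -1) (ha : Commute a i) :
    a ∈ (Complex.liftAux i hi).range := by
  let Z := Subalgebra.centralizer ℝ {i}
  let iZ : Z := ⟨i, fun _ h => by rw [Set.mem_singleton_iff.1 h]⟩
  let f : ℂ →ₐ[ℝ] Z := Complex.liftAux iZ (Subtype.ext hi)
  have commute_f (w : ℂ) (z : Z) : f w * z = z * f w := by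
    have commute_iZ : iZ * z = z * iZ := Subtype.ext (z.2 i rfl)
    simp only [f, Complex.liftAux_apply, add_mul, mul_add, Algebra.commutes, smul_mul_assoc,
      mul_smul_comm, commute_iZ]
  let : Algebra ℂ Z := f.toRingHom.toAlgebra' commute_f
  have : IsScalarTower ℝ ℂ Z := .of_algebraMap_eq fun r => (f.commutes r).symm
  have : Module.Finite ℂ Z := .of_restrictScalars_finite ℝ ℂ Z
  obtain ⟨w, hw⟩ := (IsAlgClosed.algebraMap_bijective_of_isIntegral (k := ℂ)).2
    (⟨a, fun _ h => by rw [Set.mem_singleton_iff.1 h]; exact ha.symm⟩ : Z)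
  refine ⟨w, .trans ?_ (congrArg Z.val hw)⟩
  exact congrArg (· w) (Complex.algHom_ext (f := Complex.liftAux i hi) (g := Z.val.comp f)
    (by simp [f, iZ]))

lemma exists_mul_self_eq_neg_one_of_notMem_bot {a : D} (ha : a ∉ (⊥ : Subalgebra ℝ D)) :
    ∃ (x y : ℝ) (i : D), i * i = -1 ∧ a = algebraMap ℝ D x + y • i := by
  let F := Algebra.adjoin ℝ {a}
  let : CommRing F := { (inferInstance : Ring F) with mul_comm := mul_comm' }
  let a' : F := ⟨a, Algebra.self_mem_adjoin_singleton ℝ a⟩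
  let : Field F := fieldOfFiniteDimensional ℝ F
  rcases Real.nonempty_algEquiv_or F with ⟨⟨e⟩⟩ | ⟨⟨e⟩⟩
  · refine absurd (Algebra.mem_bot.2 ⟨e a', ?_⟩) ha
    exact congrArg F.val (e.injective (e.commutes (e a')) : algebraMap ℝ F (e a') = a')
  · refine ⟨(e a').re, (e a').im, e.symm Complex.I, ?_, ?_⟩
    · exact congrArg F.val (e.injective (by simp) : e.symm Complex.I * e.symm Complex.I = -1)
    · refine congrArg F.val (e.injective ?_ :
        a' = algebraMap ℝ F (e a').re + (e a').im • e.symm Complex.I)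
      simp [Complex.re_add_im]

lemma exists_smul_mul_smul_eq_neg_one {i u : D} (hi : i * i = -1) (hu : SemiconjBy u i (-i))
    (hu_ne : u ≠ 0) : ∃ r : ℝ, (r • u) * (r • u) = -1 := by
  have notMem_bot : u ∉ (⊥ : Subalgebra ℝ D) := fun h => by
    obtain ⟨x, rfl⟩ := Algebra.mem_bot.1 h
    exact hu_ne (eq_zero_of_commute_of_semiconjBy_neg hi (Algebra.commutes x i) hu)
  obtain ⟨x, y, j, hj, hxy⟩ := exists_mul_self_eq_neg_one_of_notMem_bot notMem_bot
  have smul_eq : x • u = (1 / 2 : ℝ) • (u * u + algebraMap ℝ D (x ^ 2 + y ^ 2)) := by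
    rw [hxy]
    simp only [Algebra.algebraMap_eq_smul_one, mul_add, add_mul, smul_mul_smul_comm, hj,
      mul_one, one_mul]
    module
  have x_eq_zero : x = 0 := by
    have commute_smul : Commute (x • u) i := by
      rw [smul_eq]
      exact ((commute_mul_of_semiconjBy_neg hu hu).add_left (Algebra.commutes _ i)).smul_left _
    have := eq_zero_of_commute_of_semiconjBy_neg hi commute_smul (hu.smul_left x)
    exact (smul_eq_zero.1 this).resolve_right hu_ne
  rw [x_eq_zero, map_zero, zero_add] at hxy
  have y_ne_zero : y ≠ 0 := by
    rintro rfl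
    exact hu_ne (by rw [hxy, zero_smul])
  exact ⟨y⁻¹, by rw [hxy, inv_smul_smul₀ y_ne_zero, hj]⟩

lemma exists_anticommuting_of_not_surjective {i : D} (hi : i * i = -1)
    (h : ¬ Function.Surjective (Complex.liftAux i hi)) :
    ∃ j : D, j * j = -1 ∧ SemiconjBy j i (-i) := by
  obtain ⟨b, hb⟩ := not_forall.1 h
  have add_ne_zero : b + i * b * i ≠ 0 := fun h0 => by
    have two_smul : (2 : ℝ) • b = b - i * b * i := by
      rw [← sub_eq_zero, two_smul, ← h0]
      abel
    refine hb (mem_range_liftAux_of_commute hi ?_)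
    have := (commute_sub_mul_mul hi b).smul_left (2⁻¹ : ℝ)
    rwa [← two_smul, inv_smul_smul₀ two_ne_zero] at this
  have semiconjBy := semiconjBy_add_mul_mul hi b
  obtain ⟨r, hr⟩ := exists_smul_mul_smul_eq_neg_one hi semiconjBy add_ne_zero
  exact ⟨_, hr, semiconjBy.smul_left r⟩

lemma quaternionLift_surjective {i j : D} (hi : i * i = -1) (hj : j * j = -1)
    (hij : SemiconjBy j i (-i)) : Function.Surjective (quaternionLift hi hj hij) := by
  have mem_range_of_commute {a : D} (ha : Commute a i) :
      a ∈ (quaternionLift hi hj hij).range := by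
    obtain ⟨w, rfl⟩ := mem_range_liftAux_of_commute hi ha
    exact ⟨⟨w.re, w.im, 0, 0⟩, (quaternionLift_apply hi hj hij _).trans (by simp)⟩
  have j_mem_range : j ∈ (quaternionLift hi hj hij).range :=
    ⟨⟨0, 0, 1, 0⟩, (quaternionLift_apply hi hj hij _).trans (by simp)⟩
  intro b
  have sub_mem_range := mem_range_of_commute (commute_sub_mul_mul hi b)
  have add_mem_range := mul_mem (mem_range_of_commute
    (commute_mul_of_semiconjBy_neg (semiconjBy_add_mul_mul hi b) hij)) j_mem_range
  rw [mul_assoc, hj, mul_neg_one] at add_mem_range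
  have := Subalgebra.smul_mem _ (sub_mem sub_mem_range add_mem_range) (2⁻¹ : ℝ)
  rwa [show (2⁻¹ : ℝ) • (b - i * b * i - -(b + i * b * i)) = b by module] at this

variable (D) in
theorem nonempty_algEquiv_real_or_complex_or_quaternion :
    Nonempty (D ≃ₐ[ℝ] ℝ) ∨ Nonempty (D ≃ₐ[ℝ] ℂ) ∨ Nonempty (D ≃ₐ[ℝ] Quaternion ℝ) := by
  by_cases bot_eq_top : (⊥ : Subalgebra ℝ D) = ⊤
  · exact .inl ⟨((Subalgebra.equivOfEq _ _ bot_eq_top).trans Subalgebra.topEquiv).symm.trans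
      (Algebra.botEquiv ℝ D)⟩
  obtain ⟨a, ha⟩ : ∃ a, a ∉ (⊥ : Subalgebra ℝ D) := by
    by_contra! h
    exact bot_eq_top (Algebra.eq_top_iff.2 h)
  obtain ⟨-, -, i, hi, -⟩ := exists_mul_self_eq_neg_one_of_notMem_bot ha
  by_cases surjective : Function.Surjective (Complex.liftAux i hi)
  · exact .inr (.inl ⟨(AlgEquiv.ofBijective _ ⟨RingHom.injective _, surjective⟩).symm⟩)
  obtain ⟨j, hj, hij⟩ := exists_anticommuting_of_not_surjective hi surjective
  exact .inr (.inr ⟨(AlgEquiv.ofBijective _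
    ⟨RingHom.injective _, quaternionLift_surjective hi hj hij⟩).symm⟩)

end Frobenius

section AveragingModIdeal

variable {R : Type*} [Ring R] {J : Ideal R} {i j y : R}

lemma mul_notMem_of_mul_self_eq_neg_one [J.IsTwoSided] (hi : i * i = -1) (hy : y ∉ J) :
    y * i ∉ J := fun h => hy (by
  have := J.mul_mem_right (-i) h
  rwa [mul_assoc, mul_neg, hi, neg_neg, mul_one] at this)

variable [Algebra ℝ R] {I : Ideal R} [I.IsTwoSided]

lemma sub_notMem_or_add_notMem (hy : y ∉ J) (u : R) : y - u ∉ J ∨ y + u ∉ J := by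
  by_contra! h
  have := J.mul_mem_left (algebraMap ℝ R 2⁻¹) (J.add_mem h.1 h.2)
  rw [← Algebra.smul_def, sub_add_add_cancel, ← two_smul ℝ, inv_smul_smul₀ two_ne_zero] at this
  exact hy this

lemma exists_mem_notMem_commute_or_semiconjBy (hi : i * i = -1) (hyI : y ∈ I) (hyJ : y ∉ J) :
    ∃ x ∈ I, x ∉ J ∧ (Commute x i ∨ SemiconjBy x i (-i)) := by
  have mul_mul_mem : i * y * i ∈ I := I.mul_mem_right _ (I.mul_mem_left _ hyI)
  rcases sub_notMem_or_add_notMem hyJ (i * y * i) with h | h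
  · exact ⟨_, I.sub_mem hyI mul_mul_mem, h, .inl (commute_sub_mul_mul hi y)⟩
  · exact ⟨_, I.add_mem hyI mul_mul_mem, h, .inr (semiconjBy_add_mul_mul hi y)⟩

variable [J.IsTwoSided]

lemma exists_mem_notMem_commute (hi : i * i = -1) (hj : j * j = -1) (hij : SemiconjBy j i (-i))
    (hyI : y ∈ I) (hyJ : y ∉ J) : ∃ x ∈ I, x ∉ J ∧ Commute x i := by
  obtain ⟨x, hxI, hxJ, commute | semiconjBy⟩ :=
    exists_mem_notMem_commute_or_semiconjBy hi hyI hyJ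
  · exact ⟨x, hxI, hxJ, commute⟩
  · exact ⟨x * j, I.mul_mem_right _ hxI, mul_notMem_of_mul_self_eq_neg_one hj hxJ,
      commute_mul_of_semiconjBy_neg semiconjBy hij⟩

lemma exists_mem_notMem_commute_commute (hi : i * i = -1) (hj : j * j = -1)
    (hij : SemiconjBy j i (-i)) (hyI : y ∈ I) (hyJ : y ∉ J) :
    ∃ x ∈ I, x ∉ J ∧ Commute x i ∧ Commute x j := by
  obtain ⟨x, hxI, hxJ, hxi⟩ := exists_mem_notMem_commute hi hj hij hyI hyJ
  have mul_mul_mem : j * x * j ∈ I := I.mul_mem_right _ (I.mul_mem_left _ hxI)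
  have commute_mul_mul : Commute (j * x * j) i :=
    commute_mul_of_semiconjBy_neg (hij.mul_left hxi) hij
  rcases sub_notMem_or_add_notMem hxJ (j * x * j) with h | h
  · exact ⟨_, I.sub_mem hxI mul_mul_mem, h, hxi.sub_left commute_mul_mul,
      commute_sub_mul_mul hj x⟩
  · exact ⟨_, I.mul_mem_right i (I.add_mem hxI mul_mul_mem),
      mul_notMem_of_mul_self_eq_neg_one hi h,
      (hxi.add_left commute_mul_mul).mul_left (Commute.refl i),
      commute_mul_of_semiconjBy_neg (semiconjBy_add_mul_mul hj x) (semiconjBy_neg_symm hij)⟩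

end AveragingModIdeal

/-! ### Lifting square roots of `-1` -/

lemma semiconjBy_ofId {k A : Type*} [CommSemiring k] [Semiring A] [Algebra k A] (x : A) (w : k) :
    SemiconjBy x (Algebra.ofId k A w) (Algebra.ofId k A ((AlgEquiv.refl : k ≃ₐ[k] k) w)) :=
  (Algebra.commutes w x).symm

namespace DualAlgebra.IsPointwiseNilpotent

variable {k C : Type*} [Field k] [AddCommGroup C] [Module k C] [Coalgebra k C]
  {x : DualAlgebra k C} (hx : x.IsPointwiseNilpotent)

/-- Substitution of a pointwise nilpotent functional into power series. -/
def subst : PowerSeries k →ₐ[k] DualAlgebra k C :=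
  (SkewPowerSeries.eval hx (semiconjBy_ofId x)).comp
    (SkewPowerSeries.ofPowerSeries AlgEquiv.refl)

lemma subst_X : hx.subst PowerSeries.X = x := by
  have ofPowerSeries_X :=
    SkewPowerSeries.ofPowerSeries_X_pow (α := (AlgEquiv.refl : k ≃ₐ[k] k)) 1
  rw [pow_one] at ofPowerSeries_X
  rw [subst, AlgHom.comp_apply, ofPowerSeries_X, SkewPowerSeries.eval_monomial, map_one, one_mul,
    pow_one]

lemma commute_subst {g : DualAlgebra k C} (hg : Commute g x) (p : PowerSeries k) :
    Commute g (hx.subst p) := by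
  rw [subst, AlgHom.comp_apply]
  exact SkewPowerSeries.commute_eval hx (semiconjBy_ofId x) (fun w => (Algebra.commutes w g).symm)
    hg _

lemma subst_sub_one_mem {J : Ideal (DualAlgebra k C)} [J.IsTwoSided] (hxJ : x ∈ J)
    {p : PowerSeries k} (hp : PowerSeries.constantCoeff p = 1) : hx.subst p - 1 ∈ J := by
  obtain ⟨q, hq⟩ := PowerSeries.X_dvd_iff.2
    (by rw [map_sub, hp, map_one, sub_self] : PowerSeries.constantCoeff (p - 1) = 0)
  rw [← map_one hx.subst, ← map_sub, hq, map_mul, subst_X]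
  exact J.mul_mem_right _ hxJ

end DualAlgebra.IsPointwiseNilpotent

lemma exists_powerSeries_mul_self_mul_one_add_X :
    ∃ q : PowerSeries ℝ, q * q * (1 + PowerSeries.X) = 1 ∧ PowerSeries.constantCoeff q = 1 := by
  refine ⟨PowerSeries.binomialSeries ℝ (-1 / 2 : ℝ), ?_, by simp⟩
  have one_add_X := PowerSeries.binomialSeries_nat (R := ℝ) (A := ℝ) 1
  rw [pow_one] at one_add_X
  rw [← one_add_X, ← PowerSeries.binomialSeries_add, ← PowerSeries.binomialSeries_add]
  norm_num

lemma mul_mul_mul_eq_neg_one {R : Type*} [Ring R] {u s : R} (h : Commute u s)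
    (hs : s * s * (1 + -(u * u + 1)) = 1) : u * s * (u * s) = -1 := by
  rw [neg_add_rev, add_neg_cancel_left, mul_neg, neg_eq_iff_eq_neg] at hs
  rw [← mul_assoc, mul_assoc u, ← h.eq, ← mul_assoc, mul_assoc, ← hs,
    ((h.mul_right h).mul_left (h.mul_right h)).eq]

/-- Every square root `u` of `-1` modulo `J` can be rescaled to a square root of `-1`, by a factor
that is `1` modulo `J` and commutes with everything that commutes with `u²`. -/
def LiftsSqrtNegOne {R : Type*} [Ring R] (J : Ideal R) : Prop :=
  ∀ u, u * u + 1 ∈ J → ∃ s, s - 1 ∈ J ∧ u * s * (u * s) = -1 ∧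
    ∀ g, Commute g (u * u) → Commute g s

lemma liftsSqrtNegOne_of_forall_isPointwiseNilpotent {C : Type*} [AddCommGroup C] [Module ℝ C]
    [Coalgebra ℝ C] {J : Ideal (DualAlgebra ℝ C)} [J.IsTwoSided]
    (hJ : ∀ x ∈ J, x.IsPointwiseNilpotent) : LiftsSqrtNegOne J := fun u hu => by
  obtain ⟨q, hq, hq_one⟩ := exists_powerSeries_mul_self_mul_one_add_X
  have neg_mem := J.neg_mem hu
  have hx := hJ _ neg_mem
  have commute_subst (g) (hg : Commute g (u * u)) : Commute g (hx.subst q) :=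
    hx.commute_subst (hg.add_right (Commute.one_right g)).neg_right q
  refine ⟨hx.subst q, hx.subst_sub_one_mem neg_mem hq_one, ?_, commute_subst⟩
  refine mul_mul_mul_eq_neg_one (commute_subst u ((Commute.refl u).mul_right (.refl u))) ?_
  have subst_mul := congrArg hx.subst hq
  rwa [map_mul, map_mul, map_add, map_one, hx.subst_X] at subst_mul

section Lift

variable {R : Type*} [Ring R] {J : Ideal R} [J.IsTwoSided]

lemma mul_self_add_one_mem_iff {u : R} :
    u * u + 1 ∈ J ↔ Ideal.Quotient.mk J u * Ideal.Quotient.mk J u = -1 := by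
  rw [← Ideal.Quotient.eq_zero_iff_mem, map_add, map_mul, map_one, add_eq_zero_iff_eq_neg]

lemma LiftsSqrtNegOne.exists_mk_eq (hJ : LiftsSqrtNegOne J) {v : R ⧸ J} (hv : v * v = -1) :
    ∃ i, i * i = -1 ∧ Ideal.Quotient.mk J i = v := by
  obtain ⟨u, rfl⟩ := Ideal.Quotient.mk_surjective v
  obtain ⟨s, sub_one_mem, mul_self, -⟩ := hJ u (mul_self_add_one_mem_iff.2 hv)
  refine ⟨u * s, mul_self, Ideal.Quotient.eq.2 ?_⟩
  have := J.mul_mem_left u sub_one_mem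
  rwa [mul_sub, mul_one] at this

variable [Algebra ℝ R]

lemma LiftsSqrtNegOne.exists_semiconjBy (hJ : LiftsSqrtNegOne J) {i j : R} (hi : i * i = -1)
    (hj : j * j + 1 ∈ J) (hij : j * i + i * j ∈ J) :
    ∃ j', j' * j' = -1 ∧ SemiconjBy j' i (-i) ∧ j' - j ∈ J := by
  let u : R := (2⁻¹ : ℝ) • (j + i * j * i)
  have semiconjBy : SemiconjBy u i (-i) := (semiconjBy_add_mul_mul hi j).smul_left _
  have sub_mem : u - j ∈ J := by
    have sub_eq : u - j = algebraMap ℝ R 2⁻¹ * ((j * i + i * j) * i) := by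
      rw [← Algebra.smul_def, add_mul, mul_assoc j, hi, mul_neg_one]
      module
    rw [sub_eq]
    exact J.mul_mem_left _ (J.mul_mem_right _ hij)
  have mul_self_mem : u * u + 1 ∈ J := by
    have := J.add_mem (J.add_mem (J.mul_mem_left u sub_mem) (J.mul_mem_right j sub_mem)) hj
    rwa [← add_assoc, mul_sub, sub_mul, sub_add_sub_cancel, sub_add_cancel] at this
  obtain ⟨s, sub_one_mem, mul_self, commute⟩ := hJ u mul_self_mem
  refine ⟨u * s, mul_self, ?_, ?_⟩
  · have commute_mul_self := commute_mul_of_semiconjBy_neg semiconjBy semiconjBy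
    exact semiconjBy.mul_left (commute i commute_mul_self.symm).symm
  · have := J.add_mem (J.mul_mem_left u sub_one_mem) sub_mem
    rwa [mul_sub, mul_one, sub_add_sub_cancel] at this

lemma LiftsSqrtNegOne.exists_comp_complex (hJ : LiftsSqrtNegOne J) (ψ : ℂ →ₐ[ℝ] R ⧸ J) :
    ∃ (i : R) (hi : i * i = -1), (Ideal.Quotient.mkₐ ℝ J).comp (Complex.liftAux i hi) = ψ := by
  obtain ⟨i, hi, hiψ⟩ := hJ.exists_mk_eq
    (by rw [← map_mul, Complex.I_mul_I, map_neg, map_one] : ψ Complex.I * ψ Complex.I = -1)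
  exact ⟨i, hi, Complex.algHom_ext (by simpa using hiψ)⟩

lemma LiftsSqrtNegOne.exists_comp_quaternion (hJ : LiftsSqrtNegOne J)
    (ψ : Quaternion ℝ →ₐ[ℝ] R ⧸ J) :
    ∃ (i j : R) (hi : i * i = -1) (hj : j * j = -1) (hij : SemiconjBy j i (-i)),
      (Ideal.Quotient.mkₐ ℝ J).comp (quaternionLift hi hj hij) = ψ := by
  let q := (QuaternionAlgebra.Basis.self ℝ).compHom ψ
  obtain ⟨i, hi, hiq⟩ := hJ.exists_mk_eq (by simp [q.i_mul_i] : q.i * q.i = -1)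
  obtain ⟨u, huq⟩ := Ideal.Quotient.mk_surjective q.j
  have mul_self_mem : u * u + 1 ∈ J := mul_self_add_one_mem_iff.2 (by simp [huq, q.j_mul_j])
  have mul_add_mul_mem : u * i + i * u ∈ J := by
    rw [← Ideal.Quotient.eq_zero_iff_mem, map_add, map_mul, map_mul, hiq, huq, q.j_mul_i,
      q.i_mul_j, zero_smul, zero_sub, neg_add_cancel]
  obtain ⟨j, hj, hij, sub_mem⟩ := hJ.exists_semiconjBy hi mul_self_mem mul_add_mul_mem
  have lift_i : quaternionLift hi hj hij (QuaternionAlgebra.Basis.self ℝ).i = i :=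
    (quaternionLift_apply hi hj hij _).trans (by simp)
  have lift_j : quaternionLift hi hj hij (QuaternionAlgebra.Basis.self ℝ).j = j :=
    (quaternionLift_apply hi hj hij _).trans (by simp)
  refine ⟨i, j, hi, hj, hij, Quaternion.hom_ext ?_ ?_⟩
  · exact (congrArg _ lift_i).trans hiq
  · exact (congrArg _ lift_j).trans ((Ideal.Quotient.eq.2 sub_mem).trans huq)

end Lift

/-! ### Classification -/

section Commute

variable {R : Type*} [Ring R] [Algebra ℝ R] {x i j : R} (hi : i * i = -1)

lemma commute_liftAux (h : Commute x i) (w : ℂ) : Commute x (Complex.liftAux i hi w) := by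
  rw [Complex.liftAux_apply]
  exact (Algebra.commute_algebraMap_right _ _).add_right (h.smul_right _)

lemma semiconjBy_liftAux_conj (h : SemiconjBy x i (-i)) (w : ℂ) :
    SemiconjBy x (Complex.liftAux i hi w) (Complex.liftAux i hi (Complex.conjAe w)) := by
  rw [Complex.liftAux_apply, Complex.liftAux_apply, Complex.conjAe_coe, Complex.conj_re,
    Complex.conj_im, neg_smul, ← smul_neg]
  exact .add_right (Algebra.commute_algebraMap_right _ _) (h.smul_right _)

lemma commute_quaternionLift (hj : j * j = -1) (hij : SemiconjBy j i (-i)) (hxi : Commute x i)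
    (hxj : Commute x j) (q : Quaternion ℝ) : Commute x (quaternionLift hi hj hij q) := by
  rw [quaternionLift_apply]
  exact (((Algebra.commute_algebraMap_right _ _).add_right (hxi.smul_right _)).add_right
    (hxj.smul_right _)).add_right ((hxi.mul_right hxj).smul_right _)

end Commute

lemma exists_sub_mem_of_mkₐ_comp_eq {k R D : Type*} [Field k] [Ring R] [Algebra k R] [Ring D]
    [Algebra k D] {J : Ideal R} [J.IsTwoSided] (e : (R ⧸ J) ≃ₐ[k] D) {φ : D →ₐ[k] R}
    (hφ : (Ideal.Quotient.mkₐ k J).comp φ = e.symm.toAlgHom) (f : R) : ∃ w, f - φ w ∈ J := by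
  refine ⟨e (Ideal.Quotient.mk J f), Ideal.Quotient.eq.1 ?_⟩
  exact ((DFunLike.congr_fun hφ _).trans (e.symm_apply_apply _)).symm

section

variable {k C D : Type*} [Field k] [AddCommGroup C] [Module k C] [Coalgebra k C] [DivisionRing D]
  [Algebra k D] [FiniteDimensional k D] {S T : Submodule k C} {hS' : IsSubcoalgebra S}
  (hinf : ¬ FiniteDimensional k C) (hC : IsChainCoalgebra k C) (hS : IsSmallestCoideal S)
  (hT : IsNextCoideal S T) (hT' : IsSubcoalgebra T)
  (e : (DualAlgebra k C ⧸ hS'.annihilator) ≃ₐ[k] D) {φ : D →ₐ[k] DualAlgebra k C}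
  (hφ : (Ideal.Quotient.mkₐ k hS'.annihilator).comp φ = e.symm.toAlgHom) {x : DualAlgebra k C}
  (hxS : x ∈ hS'.annihilator) (hxT : x ∉ hT'.annihilator)
include hinf hC hS hT hφ hxS hxT

lemma nonempty_coalgEquiv_finiteDual_skewPowerSeries {α : D ≃ₐ[k] D}
    (h : ∀ w, SemiconjBy x (φ w) (φ (α w))) :
    Nonempty (C ≃ₗc[k] finiteDual k (SkewPowerSeries α)) :=
  hT.nonempty_coalgEquiv_finiteDual hinf hS' hT' (exists_sub_mem_of_mkₐ_comp_eq e hφ)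
    (hS.isPointwiseNilpotent hC hS' hxS) hxT h

lemma nonempty_coalgEquiv_finiteDual_powerSeries (h : ∀ w, Commute x (φ w)) :
    Nonempty (C ≃ₗc[k] finiteDual k (PowerSeries D)) :=
  (nonempty_coalgEquiv_finiteDual_skewPowerSeries (α := AlgEquiv.refl) hinf hC hS hT hT' e hφ
    hxS hxT h).map fun e' => e'.trans (finiteDual.congr (SkewPowerSeries.reflEquiv k D))

end

section

variable {C : Type*} [AddCommGroup C] [Module ℝ C] [Coalgebra ℝ C] {S T : Submodule ℝ C}
  {hS' : IsSubcoalgebra S} (hinf : ¬ FiniteDimensional ℝ C) (hC : IsChainCoalgebra ℝ C)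
  (hS : IsSmallestCoideal S) (hT : IsNextCoideal S T) (hT' : IsSubcoalgebra T)
include hinf hC hS hT hT'

lemma nonempty_coalgEquiv_of_quotient_equiv_real
    (e : (DualAlgebra ℝ C ⧸ hS'.annihilator) ≃ₐ[ℝ] ℝ) : Nonempty (C ≃ₗc[ℝ] RealSeriesDual) := by
  obtain ⟨x, hxS, hxT⟩ := hS'.exists_mem_annihilator_notMem_annihilator hT' hT.lt
  exact nonempty_coalgEquiv_finiteDual_powerSeries hinf hC hS hT hT' e (φ := Algebra.ofId ℝ _)
    (Subsingleton.elim _ _) hxS hxT (semiconjBy_ofId x)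

lemma nonempty_coalgEquiv_of_quotient_equiv_complex
    (e : (DualAlgebra ℝ C ⧸ hS'.annihilator) ≃ₐ[ℝ] ℂ) :
    Nonempty (C ≃ₗc[ℝ] ComplexSeriesDual) ∨ Nonempty (C ≃ₗc[ℝ] SkewComplexSeriesDual) := by
  have lifts := liftsSqrtNegOne_of_forall_isPointwiseNilpotent fun _ =>
    hS.isPointwiseNilpotent hC hS'
  obtain ⟨i, hi, hφ⟩ := lifts.exists_comp_complex e.symm.toAlgHom
  obtain ⟨y, hyS, hyT⟩ := hS'.exists_mem_annihilator_notMem_annihilator hT' hT.lt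
  obtain ⟨x, hxS, hxT, commute | semiconjBy⟩ :=
    exists_mem_notMem_commute_or_semiconjBy hi hyS hyT
  · exact .inl (nonempty_coalgEquiv_finiteDual_powerSeries hinf hC hS hT hT' e hφ hxS hxT
      (commute_liftAux hi commute))
  · exact .inr (nonempty_coalgEquiv_finiteDual_skewPowerSeries hinf hC hS hT hT' e hφ hxS hxT
      (semiconjBy_liftAux_conj hi semiconjBy))

lemma nonempty_coalgEquiv_of_quotient_equiv_quaternion
    (e : (DualAlgebra ℝ C ⧸ hS'.annihilator) ≃ₐ[ℝ] Quaternion ℝ) :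
    Nonempty (C ≃ₗc[ℝ] QuaternionSeriesDual) := by
  have lifts := liftsSqrtNegOne_of_forall_isPointwiseNilpotent fun _ =>
    hS.isPointwiseNilpotent hC hS'
  obtain ⟨i, j, hi, hj, hij, hφ⟩ := lifts.exists_comp_quaternion e.symm.toAlgHom
  obtain ⟨y, hyS, hyT⟩ := hS'.exists_mem_annihilator_notMem_annihilator hT' hT.lt
  obtain ⟨x, hxS, hxT, hxi, hxj⟩ := exists_mem_notMem_commute_commute hi hj hij hyS hyT
  exact nonempty_coalgEquiv_finiteDual_powerSeries hinf hC hS hT hT' e hφ hxS hxT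
    (commute_quaternionLift hi hj hij hxi hxj)

end

theorem IsChainCoalgebra.nonempty_coalgEquiv_seriesDual {C : Type*} [AddCommGroup C] [Module ℝ C]
    [Coalgebra ℝ C] (hC : IsChainCoalgebra ℝ C) (hinf : ¬ FiniteDimensional ℝ C) :
    Nonempty (C ≃ₗc[ℝ] RealSeriesDual) ∨ Nonempty (C ≃ₗc[ℝ] ComplexSeriesDual) ∨
      Nonempty (C ≃ₗc[ℝ] SkewComplexSeriesDual) ∨ Nonempty (C ≃ₗc[ℝ] QuaternionSeriesDual) := by
  have ne_top {N : Submodule ℝ C} (hN : FiniteDimensional ℝ N) : N ≠ ⊤ := by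
    rintro rfl
    exact hinf (Module.Finite.of_surjective _ (Submodule.topEquiv (R := ℝ) (M := C)).surjective)
  obtain ⟨S, hS⟩ := hC.exists_isNextCoideal isRightCoideal_bot (ne_top inferInstance)
  obtain ⟨T, hT⟩ := hC.exists_isNextCoideal hS.isRightCoideal (ne_top hS.finiteDimensional)
  have := hS.finiteDimensional
  have := hT.finiteDimensional
  have hS' := hC.isSubcoalgebra hS.isRightCoideal
  have hT' := hC.isSubcoalgebra hT.isRightCoideal
  have := hS'.finiteDimensional_quotient_annihilator
  have := IsSmallestCoideal.isDomain_quotient_annihilator hS hS'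
  rcases nonempty_algEquiv_real_or_complex_or_quaternion (DualAlgebra ℝ C ⧸ hS'.annihilator) with
    ⟨⟨e⟩⟩ | ⟨⟨e⟩⟩ | ⟨⟨e⟩⟩
  · exact .inl (nonempty_coalgEquiv_of_quotient_equiv_real hinf hC hS hT hT' e)
  · rcases nonempty_coalgEquiv_of_quotient_equiv_complex hinf hC hS hT hT' e with h | h
    · exact .inr (.inl h)
    · exact .inr (.inr (.inl h))
  · exact .inr (.inr (.inr (nonempty_coalgEquiv_of_quotient_equiv_quaternion hinf hC hS hT hT' e)))

/-! ### The finite duals of power series rings -/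

section PowerSeries

variable {k : Type*} [Field k] (D : Type*) [DivisionRing D] [Algebra k D] [FiniteDimensional k D]

variable (k) in
/-- The finite duals of `D[[x]]` as a skew and as an ordinary power series ring agree. -/
def powerSeriesDualEquiv :
    finiteDual k (PowerSeries D) ≃ₗc[k]
      finiteDual k (SkewPowerSeries (AlgEquiv.refl : D ≃ₐ[k] D)) :=
  finiteDual.congr (SkewPowerSeries.reflEquiv k D).symm

theorem isChainCoalgebra_finiteDual_powerSeries :
    IsChainCoalgebra k (finiteDual k (PowerSeries D)) :=
  (SkewPowerSeries.isChainCoalgebra_finiteDual _).of_injective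
    (powerSeriesDualEquiv k D).toCoalgHom (powerSeriesDualEquiv k D).injective

lemma not_finiteDimensional_finiteDual_powerSeries :
    ¬ FiniteDimensional k (finiteDual k (PowerSeries D)) := fun _ =>
  SkewPowerSeries.not_finiteDimensional_finiteDual _
    (Module.Finite.equiv (powerSeriesDualEquiv k D).toLinearEquiv)

variable {D} {D' : Type*} [DivisionRing D'] [Algebra k D'] [FiniteDimensional k D']

lemma finrank_eq_of_coalgEquiv_finiteDual {α : D ≃ₐ[k] D} {β : D' ≃ₐ[k] D'}
    (e : finiteDual k (SkewPowerSeries α) ≃ₗc[k] finiteDual k (SkewPowerSeries β)) :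
    Module.finrank k D = Module.finrank k D' := by
  have finrank_eq := IsSmallestCoideal.finrank_eq_of_coalgEquiv
    (SkewPowerSeries.isSmallestCoideal_vanishingOn_orderIdeal α)
    (SkewPowerSeries.isSmallestCoideal_vanishingOn_orderIdeal β) e
  rwa [SkewPowerSeries.finrank_vanishingOn_orderIdeal,
    SkewPowerSeries.finrank_vanishingOn_orderIdeal, one_mul, one_mul] at finrank_eq

lemma isEmpty_coalgEquiv_of_finrank_ne (h : Module.finrank k D ≠ Module.finrank k D')
    {C C' : Type*} [AddCommMonoid C] [Module k C] [Coalgebra k C] [AddCommMonoid C'] [Module k C']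
    [Coalgebra k C'] {α : D ≃ₐ[k] D} {β : D' ≃ₐ[k] D'}
    (e : C ≃ₗc[k] finiteDual k (SkewPowerSeries α))
    (e' : C' ≃ₗc[k] finiteDual k (SkewPowerSeries β)) : IsEmpty (C ≃ₗc[k] C') :=
  ⟨fun f => h (finrank_eq_of_coalgEquiv_finiteDual ((e.symm.trans f).trans e'))⟩

end PowerSeries

lemma isEmpty_complexSeriesDual_coalgEquiv_skewComplexSeriesDual :
    IsEmpty (ComplexSeriesDual ≃ₗc[ℝ] SkewComplexSeriesDual) := ⟨fun e => by
  have := isCocomm_of_coalgEquiv e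
  let x := SkewPowerSeries.monomial Complex.conjAe 1 1
  let i := SkewPowerSeries.monomial Complex.conjAe 0 Complex.I
  have mem : x * i - i * x ∈ SkewPowerSeries.orderIdeal Complex.conjAe 2 :=
    finiteDual.mem_of_forall_mem_vanishingOn (k := ℝ) fun f _ => by
      rw [map_sub, finiteDual.apply_mul_comm, sub_self]
  have coeff_eq_zero := SkewPowerSeries.mem_orderIdeal.1 mem 1 one_lt_two
  rw [SkewPowerSeries.coeff_sub, SkewPowerSeries.monomial_mul_monomial,
    SkewPowerSeries.monomial_mul_monomial, SkewPowerSeries.coeff_monomial_self,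
    SkewPowerSeries.coeff_monomial_self] at coeff_eq_zero
  have := congrArg Complex.im coeff_eq_zero
  norm_num at this⟩

end

theorem mainTheorem10 :
    -- each of the four coalgebras is an infinite-dimensional chain coalgebra
    ((¬ FiniteDimensional ℝ RealSeriesDual ∧ IsChainCoalgebra ℝ RealSeriesDual) ∧
      (¬ FiniteDimensional ℝ ComplexSeriesDual ∧ IsChainCoalgebra ℝ ComplexSeriesDual) ∧
      (¬ FiniteDimensional ℝ SkewComplexSeriesDual ∧ IsChainCoalgebra ℝ SkewComplexSeriesDual) ∧
      (¬ FiniteDimensional ℝ QuaternionSeriesDual ∧ IsChainCoalgebra ℝ QuaternionSeriesDual)) ∧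
    -- every infinite-dimensional real chain coalgebra is isomorphic to one of them
    (∀ (C : Type*) [AddCommGroup C] [Module ℝ C] [Coalgebra ℝ C],
      ¬ FiniteDimensional ℝ C → IsChainCoalgebra ℝ C →
        Nonempty (C ≃ₗc[ℝ] RealSeriesDual) ∨ Nonempty (C ≃ₗc[ℝ] ComplexSeriesDual) ∨
          Nonempty (C ≃ₗc[ℝ] SkewComplexSeriesDual) ∨
          Nonempty (C ≃ₗc[ℝ] QuaternionSeriesDual)) ∧
    -- no two of the four are isomorphic
    (IsEmpty (RealSeriesDual ≃ₗc[ℝ] ComplexSeriesDual) ∧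
      IsEmpty (RealSeriesDual ≃ₗc[ℝ] SkewComplexSeriesDual) ∧
      IsEmpty (RealSeriesDual ≃ₗc[ℝ] QuaternionSeriesDual) ∧
      IsEmpty (ComplexSeriesDual ≃ₗc[ℝ] SkewComplexSeriesDual) ∧
      IsEmpty (ComplexSeriesDual ≃ₗc[ℝ] QuaternionSeriesDual) ∧
      IsEmpty (SkewComplexSeriesDual ≃ₗc[ℝ] QuaternionSeriesDual)) := by
  have real_ne_complex : Module.finrank ℝ ℝ ≠ Module.finrank ℝ ℂ := by simp
  have real_ne_quaternion : Module.finrank ℝ ℝ ≠ Module.finrank ℝ (Quaternion ℝ) := by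
    simp [Quaternion.finrank_eq_four]
  have complex_ne_quaternion : Module.finrank ℝ ℂ ≠ Module.finrank ℝ (Quaternion ℝ) := by
    simp [Quaternion.finrank_eq_four]
  have real := powerSeriesDualEquiv ℝ ℝ
  have complex := powerSeriesDualEquiv ℝ ℂ
  have skewComplex := CoalgEquiv.refl ℝ SkewComplexSeriesDual
  have quaternion := powerSeriesDualEquiv ℝ (Quaternion ℝ)
  refine ⟨⟨⟨not_finiteDimensional_finiteDual_powerSeries ℝ,
        isChainCoalgebra_finiteDual_powerSeries ℝ⟩,
      ⟨not_finiteDimensional_finiteDual_powerSeries ℂ, isChainCoalgebra_finiteDual_powerSeries ℂ⟩,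
      ⟨SkewPowerSeries.not_finiteDimensional_finiteDual _,
        SkewPowerSeries.isChainCoalgebra_finiteDual _⟩,
      ⟨not_finiteDimensional_finiteDual_powerSeries _, isChainCoalgebra_finiteDual_powerSeries _⟩⟩,
    fun C _ _ _ hinf hC => hC.nonempty_coalgEquiv_seriesDual hinf, ?_, ?_, ?_, ?_, ?_, ?_⟩
  · exact isEmpty_coalgEquiv_of_finrank_ne real_ne_complex real complex
  · exact isEmpty_coalgEquiv_of_finrank_ne real_ne_complex real skewComplex
  · exact isEmpty_coalgEquiv_of_finrank_ne real_ne_quaternion real quaternion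
  · exact isEmpty_complexSeriesDual_coalgEquiv_skewComplexSeriesDual
  · exact isEmpty_coalgEquiv_of_finrank_ne complex_ne_quaternion complex quaternion
  · exact isEmpty_coalgEquiv_of_finrank_ne complex_ne_quaternion skewComplex quaternion
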